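/- Operators on $\ell^2(\mathbb N)$ (one mode) and on $\ell^2(\mathbb N^M)$ ($M$ modes) are described in the Fock basis $|n\rangle$; $P_N=\sum_{n<N}|n\rangle\langle n|$, $N,M\ge 1$, and $\|\cdot\|_\infty$ is the operator norm. For each mode $i=1,\dots,M$ let $X_i$ be a measurable space with a $\sigma$-finite measure $d\mu^i$, let $|\mu^i\rangle$, $\mu^i\in X_i$, be a family of states or distributions with $\langle n|\mu^i\rangle\in L^2(X_i)$ that resolves the identity, $\int d\mu^i\,|\mu^i\rangle\langle\mu^i|=1$, and let $\sigma(\mu^i)$ be measurable Hermitian $N\times N$ matrices (the snapshots, truncated by $P_N$) with $\int d\mu^i\,\langle\mu^i|\tau|\mu^i\rangle\,\sigma(\mu^i)=P_N\tau P_N$ for every single-mode density operator $\tau$. (For trace-class $A$, $\mu\mapsto\langle\mu|A|\mu\rangle$ denotes the $L^1$-limit of its truncations to finite sets of Fock states.) For $\boldsymbol\mu=(\mu^1,\dots,\mu^M)$ write $|\boldsymbol\mu\rangle=\bigotimes_i|\mu^i\rangle$ and $\boldsymbol\sigma(\boldsymbol\mu)=\bigotimes_{i=1}^M\sigma(\mu^i)$,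 an $N^M\times N^M$ matrix. Let $\boldsymbol\rho$ be an $M$-mode density operator (possibly entangled) with an expansion $\boldsymbol\rho=\sum_\alpha c_\alpha\bigotimes_{i=1}^M\rho_\alpha^i$, where $c_\alpha\in\mathbb C$, $\sum_\alpha|c_\alpha|<\infty$, and the $\rho_\alpha^i$ are trace-class operators with uniformly bounded trace norms. Let $\mathbb E_{\boldsymbol\mu}$ denote expectation over outcomes $\boldsymbol\mu$ with density $p(\boldsymbol\mu)=\langle\boldsymbol\mu|\boldsymbol\rho|\boldsymbol\mu\rangle$. Put $$\nu_1^2=\sup_{\alpha,i}\Big\|\int d\mu^i\,\langle\mu^i|\rho^i_\alpha|\mu^i\rangle\,\sigma(\mu^i)^2\Big\|_\infty ,\qquad R\ \ge\ \|\boldsymbol\sigma(\boldsymbol\mu)-\mathbb E_{\boldsymbol\mu}\boldsymbol\sigma(\boldsymbol\mu)\|_\infty\ \text{ for all }\boldsymbol\mu .$$ Then the multimode variance satisfies $\big\|\mathbb E_{\boldsymbol\mu}\,\boldsymbol\sigma(\boldsymbol\mu)^2\big\|_\infty\le\nu_1^{2M}\sum_\alpha|c_\alpha|$. Moreover, for all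 $\epsilon,\delta\in(0,1)$ and every integer $$T\ \ge\ \frac{2N^{2M}\big(\nu_1^{2M}\sum_\alpha|c_\alpha|+\tfrac{R\epsilon}{2N}\big)}{\epsilon^2}\Big(\log 2N+\log\tfrac1\delta\Big),$$ the shadow $\boldsymbol\sigma_T=\frac1T\sum_{t=1}^T\boldsymbol\sigma(\boldsymbol\mu_t)$ built from $T$ independent outcomes $\boldsymbol\mu_t$ of this measurement on $\boldsymbol\rho$ satisfies $$\Pr\big(\|\boldsymbol\sigma_T-P_N^{\otimes M}\boldsymbol\rho P_N^{\otimes M}\|_\infty\le\epsilon\big)\ \ge\ 1-\delta .$$ -/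

import Mathlib

open MeasureTheory ProbabilityTheory Filter Topology
open scoped Matrix.Norms.L2Operator ComplexConjugate ComplexOrder

/- Operators on a Fock space are given by their matrix elements in the Fock (occupation-number)
basis: the index type is `ℕ` for one mode, and `Fin M → ℕ` for `M` modes.  Norms of finite
matrices are operator norms (Schatten-`∞` norms). -/

noncomputable section

/-- `ρ` is a density operator: positive semidefinite (on all finitely supported vectors) and of
trace one.  A positive semidefinite array whose diagonal has finite sum is the matrix of a positive
trace-class operator on `ℓ²(ι)`. -/
structure IsDensityOperator {ι : Type*} (ρ : Matrix ι ι ℂ) : Prop where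
  posSemidef : ρ.PosSemidef
  trace_one : HasSum (fun n => ρ n n) 1

/-- `A` is (the matrix of) a trace-class operator on `ℓ²(ℕ)` of trace norm at most `K`:
`A = ∑ₖ sₖ |uₖ⟩⟨vₖ|` with `sₖ ≥ 0`, `∑ₖ sₖ ≤ K` and `uₖ`, `vₖ` in the unit ball. -/
def TraceNormLE (A : Matrix ℕ ℕ ℂ) (K : ℝ) : Prop :=
  ∃ (s : ℕ → ℝ) (u v : ℕ → lp (fun _ : ℕ => ℂ) 2),
    (∀ k, 0 ≤ s k) ∧ Summable s ∧ ∑' k, s k ≤ K ∧ (∀ k, ‖u k‖ ≤ 1) ∧ (∀ k, ‖v k‖ ≤ 1) ∧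
      ∀ m n, HasSum (fun k => (s k : ℂ) * u k m * conj (v k n)) (A m n)

/-- With `ψ n μ = ⟨n|μ⟩`, the value `⟨μ| P A P |μ⟩` where `P` is the projection onto the finite set
`s` of basis vectors. -/
def bornTrunc {ι X : Type*} (ψ : ι → X → ℂ) (A : Matrix ι ι ℂ) (s : Finset ι) (μ : X) : ℂ :=
  ∑ m ∈ s, ∑ n ∈ s, conj (ψ m μ) * A m n * ψ n μ

/-- `f` is (a version of) the function `μ ↦ ⟨μ|A|μ⟩`: the `L¹`-limit of `⟨μ| P A P |μ⟩` as the
finite-dimensional projections `P` increase to the identity. -/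
def IsBornDensity {ι X : Type*} [MeasurableSpace X] (vol : Measure X) (ψ : ι → X → ℂ)
    (A : Matrix ι ι ℂ) (f : X → ℂ) : Prop :=
  Integrable f vol ∧
    Tendsto (fun s : Finset ι => ∫ μ, ‖f μ - bornTrunc ψ A s μ‖ ∂vol) atTop (𝓝 0)

open Classical in
/-- The function `μ ↦ ⟨μ|A|μ⟩` (unique up to null sets). -/
def bornDensity {ι X : Type*} [MeasurableSpace X] (vol : Measure X) (ψ : ι → X → ℂ)
    (A : Matrix ι ι ℂ) : X → ℂ :=
  if h : ∃ f, IsBornDensity vol ψ A f then h.choose else 0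

/-- The distribution `p(μ) dμ`, `p(μ) = ⟨μ|ρ|μ⟩`, of the outcome of the measurement on `ρ`. -/
def outcomeLaw {ι X : Type*} [MeasurableSpace X] (vol : Measure X) (ψ : ι → X → ℂ)
    (ρ : Matrix ι ι ℂ) : Measure X :=
  vol.withDensity fun μ => ENNReal.ofReal (bornDensity vol ψ ρ μ).re

/-- A single-mode shadow protocol regularized to the first `N` Fock levels.  The outcome space `X`
carries the reference measure `vol`; outcome `μ` belongs to a state or distribution `|μ⟩` with Fock
amplitudes `ψ n μ = ⟨n|μ⟩`; the snapshot `σ μ` is the regularized operator `P_N σ(μ) P_N`. -/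
structure IsShadowProtocol (N : ℕ) {X : Type*} [MeasurableSpace X] (vol : Measure X)
    (ψ : ℕ → X → ℂ) (σ : X → Matrix (Fin N) (Fin N) ℂ) : Prop where
  amp_memLp : ∀ n, MemLp (ψ n) 2 vol
  /-- resolution of the identity: `∫ |μ⟩⟨μ| dμ = 1` -/
  resolution : ∀ m n, ∫ μ, ψ m μ * conj (ψ n μ) ∂vol = if m = n then 1 else 0
  snapshot_measurable : ∀ j k, Measurable fun μ => σ μ j k
  snapshot_hermitian : ∀ μ, (σ μ).IsHermitian
  /-- `∫ ⟨μ|τ|μ⟩ P_N σ(μ) P_N dμ = P_N τ P_N` for every state `τ` -/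
  reconstruct : ∀ τ : Matrix ℕ ℕ ℂ, IsDensityOperator τ → ∀ j k : Fin N,
    ∫ μ, bornDensity vol ψ τ μ * σ μ j k ∂vol = τ j k

/-- `∫ ⟨μ|A|μ⟩ σ(μ)² dμ`, that is, `𝔼_μ σ(μ)²` for single-mode outcomes generated by `A`. -/
def secondMoment {N : ℕ} {X : Type*} [MeasurableSpace X] (vol : Measure X) (ψ : ℕ → X → ℂ)
    (σ : X → Matrix (Fin N) (Fin N) ℂ) (A : Matrix ℕ ℕ ℂ) : Matrix (Fin N) (Fin N) ℂ :=
  Matrix.of fun j k => ∫ μ, bornDensity vol ψ A μ * (σ μ ^ 2) j k ∂vol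

/-- Fock amplitudes of the product `|μ⟩ = |μ¹⟩ ⊗ ⋯ ⊗ |μᴹ⟩`. -/
def prodAmp {M : ℕ} {X : Fin M → Type*} (ψ : ∀ i, ℕ → X i → ℂ) (a : Fin M → ℕ)
    (μ : ∀ i, X i) : ℂ :=
  ∏ i, ψ i (a i) (μ i)

/-- The tensor product `A¹ ⊗ ⋯ ⊗ Aᴹ`. -/
def tensorOp {M : ℕ} {κ : Type*} (A : Fin M → Matrix κ κ ℂ) :
    Matrix (Fin M → κ) (Fin M → κ) ℂ :=
  Matrix.of fun a b => ∏ i, A i (a i) (b i)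

/-- The regularized `M`-mode operator `P_N^{⊗M} ρ P_N^{⊗M}`, as a matrix of size `N ^ M`. -/
def regularize {M : ℕ} (N : ℕ) (ρ : Matrix (Fin M → ℕ) (Fin M → ℕ) ℂ) :
    Matrix (Fin M → Fin N) (Fin M → Fin N) ℂ :=
  Matrix.of fun a b => ρ (fun i => (a i : ℕ)) (fun i => (b i : ℕ))

/-- Expectation of a matrix-valued random variable, entry by entry. -/
def matrixExp {X κ : Type*} [MeasurableSpace X] (P : Measure X) (F : X → Matrix κ κ ℂ) :
    Matrix κ κ ℂ :=
  Matrix.of fun a b => ∫ μ, F μ a b ∂P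

/-- The product snapshot `σ(μ¹) ⊗ ⋯ ⊗ σ(μᴹ)`. -/
def localSnapshot {M N : ℕ} {X : Fin M → Type*} (σ : ∀ i, X i → Matrix (Fin N) (Fin N) ℂ)
    (μ : ∀ i, X i) : Matrix (Fin M → Fin N) (Fin M → Fin N) ℂ :=
  tensorOp fun i => σ i (μ i)

/-- The shadow of size `T`: the average of the product snapshots of `T` outcomes. -/
def localShadow {M N : ℕ} {X : Fin M → Type*} (σ : ∀ i, X i → Matrix (Fin N) (Fin N) ℂ)
    {T : ℕ} (μ : Fin T → ∀ i, X i) : Matrix (Fin M → Fin N) (Fin M → Fin N) ℂ :=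
  (T : ℂ)⁻¹ • ∑ t, localSnapshot σ (μ t)

end

/-!
Two facts carry the theorem.

*Expectations of product observables.* Orthonormality of the amplitudes in `L²` makes
`(u, v) ↦ ⟨μ|u⟩⟨v|μ⟩` a contractive sesquilinear map from `ℓ²` to `L¹` (`exists_bilin_L1`). Hence the
truncations of `⟨μ|A|μ⟩` converge in `L¹`, both for trace-class operators, by dominated convergence
along their rank-one expansion (`linTrunc_of_traceClass`), and for positive semidefinite matrices of
finite trace, where a Gram decomposition of finite blocks gives a Cauchy estimate
(`norm_linTrunc_sub_le`). So `∫ ⟨μ|A|μ⟩ g(μ) dμ` is the limit of finite sums of the entries of `A`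
against the matrix elements of the observable with bounded symbol `g`. For product symbols these
matrix elements factorize over the modes, and summation over boxes `{0, …, n - 1} ^ M` turns the
expansion of `ρ` into `𝔼 σ² = ∑ c_α ⨂ᵢ 𝔼_{α,i} σ²` (`hasSum_integral_prod`). The operator norm of a
tensor product is at most the product of the norms (`norm_tensorOp_le`), which bounds the variance.
The same limit, with polarization to pass from states to matrix units, shows that the product
snapshot is unbiased (`matrixExp_localSnapshot`). The snapshots of the single modes are bounded
because their tensor product is and none of them vanishes identically (`exists_snapshot_bound`).

*Concentration.* The required number of samples has room for estimating the operator norm by the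
Frobenius norm: the latter has second moment at most `N ^ M` times the variance above, and satisfies
a Bernstein inequality without a dimensional factor (`measure_norm_sum_ge_le`). Its proof bounds
`𝔼 cosh ‖Y₁ + ⋯ + Y_T‖` for independent centered vectors, one summand at a time, by
`cosh ‖s + x‖ ≤ cosh ‖s‖ (exp ‖x‖ - ‖x‖) + ⟨g(s), x⟩` (`cosh_norm_add_le`), whose last term has
expectation zero. If the variance bound vanishes, the snapshot is almost surely zero and the claim
holds for every `T`, including `T = 0`.
-/

/-! ### Truncations of trace-class operators -/

section Truncation

variable {ι Z : Type*} [NormedAddCommGroup Z] [NormedSpace ℂ Z]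

/-- The projection of the vector `∑ n, u n |n⟩` onto the finite set `s` of basis vectors. -/
noncomputable def fockProj [DecidableEq ι] (s : Finset ι) (u : ι → ℂ) : lp (fun _ : ι => ℂ) 2 :=
  ∑ n ∈ s, lp.single 2 n (u n)

/-- The value on `P A P` of the linear map that sends `|m⟩⟨n|` to `e m n`, where `P` is the
projection onto the finite set `s` of basis vectors. -/
def linTrunc (e : ι → ι → Z) (A : Matrix ι ι ℂ) (s : Finset ι) : Z :=
  ∑ m ∈ s, ∑ n ∈ s, A m n • e m n

variable [DecidableEq ι]

theorem norm_fockProj_sq (s : Finset ι) (u : ι → ℂ) :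
    ‖fockProj s u‖ ^ 2 = ∑ n ∈ s, ‖u n‖ ^ 2 := by
  have := lp.norm_sum_single (p := 2) (E := fun _ : ι => ℂ) (by norm_num) u s
  simpa [fockProj] using this

theorem norm_fockProj_le (s : Finset ι) (u : lp (fun _ : ι => ℂ) 2) :
    ‖fockProj s u‖ ≤ ‖u‖ := by
  have h1 := norm_fockProj_sq s u
  have h2 := lp.norm_sub_norm_compl_sub_single (p := 2) (by norm_num) u s
  simp only [ENNReal.toReal_ofNat, Real.rpow_ofNat] at h2
  refine le_of_sq_le_sq ?_ (norm_nonneg _)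
  rw [h1]
  nlinarith [sq_nonneg ‖u - ∑ i ∈ s, lp.single 2 i (u i)‖]

theorem tendsto_fockProj (u : lp (fun _ : ι => ℂ) 2) :
    Tendsto (fun s : Finset ι => fockProj s u) atTop (𝓝 u) :=
  lp.hasSum_single (by norm_num) u

variable (Φ : lp (fun _ : ι => ℂ) 2 →L[ℂ] lp (fun _ : ι => ℂ) 2 →L[ℂ] Z)

theorem bilin_fockProj (s t : Finset ι) (u v : ι → ℂ) :
    Φ (fockProj s u) (fockProj t v) =
      ∑ m ∈ s, ∑ n ∈ t, (u m * v n) • Φ (lp.single 2 m 1) (lp.single 2 n 1) := by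
  have h : ∀ (n : ι) (c : ℂ), lp.single (E := fun _ : ι => ℂ) 2 n c = c • lp.single 2 n 1 := by
    intro n c
    rw [← lp.single_smul, smul_eq_mul, mul_one]
  unfold fockProj
  rw [map_sum Φ, sum_apply]
  refine Finset.sum_congr rfl fun m _ => ?_
  rw [map_sum]
  refine Finset.sum_congr rfl fun n _ => ?_
  rw [h m, h n]
  simp [smul_smul, mul_comm]

/-- The truncations of a rank-one expansion `A = ∑ₖ sₖ |uₖ⟩⟨vₖ|`, term by term. -/
theorem hasSum_linTrunc {κ : Type*} {A : Matrix ι ι ℂ} (s : κ → ℂ)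
    (u v : κ → ι → ℂ) (hA : ∀ m n, HasSum (fun k => s k * u k m * v k n) (A m n))
    (S : Finset ι) :
    HasSum (fun k => s k • Φ (fockProj S (u k)) (fockProj S (v k)))
      (linTrunc (fun m n => Φ (lp.single 2 m 1) (lp.single 2 n 1)) A S) := by
  have : HasSum (fun k => ∑ m ∈ S, ∑ n ∈ S,
      (s k * u k m * v k n) • Φ (lp.single 2 m 1) (lp.single 2 n 1))
      (linTrunc (fun m n => Φ (lp.single 2 m 1) (lp.single 2 n 1)) A S) :=
    hasSum_sum fun m _ => hasSum_sum fun n _ => (hA m n).smul_const _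
  convert this using 2 with k
  rw [bilin_fockProj, Finset.smul_sum]
  refine Finset.sum_congr rfl fun m _ => ?_
  rw [Finset.smul_sum]
  refine Finset.sum_congr rfl fun n _ => ?_
  rw [smul_smul, mul_assoc]

variable {Φ} (hΦ : ∀ u v, ‖Φ u v‖ ≤ ‖u‖ * ‖v‖)
include hΦ

/-- Truncations of a trace-class operator: they are bounded by the trace norm, and converge. -/
theorem linTrunc_of_traceClass [CompleteSpace Z] {A : Matrix ι ι ℂ} {K : ℝ} (s : ℕ → ℝ)
    (u v : ℕ → lp (fun _ : ι => ℂ) 2) (hs : ∀ k, 0 ≤ s k) (hsum : Summable s)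
    (hK : ∑' k, s k ≤ K) (hu : ∀ k, ‖u k‖ ≤ 1) (hv : ∀ k, ‖v k‖ ≤ 1)
    (hA : ∀ m n, HasSum (fun k => (s k : ℂ) * u k m * conj (v k n)) (A m n)) :
    (∀ S, ‖linTrunc (fun m n => Φ (lp.single 2 m 1) (lp.single 2 n 1)) A S‖ ≤ K) ∧
    ∃ z, Tendsto (linTrunc (fun m n => Φ (lp.single 2 m 1) (lp.single 2 n 1)) A) atTop (𝓝 z) := by
  have hH := hasSum_linTrunc Φ (fun k => (s k : ℂ)) (fun k => u k) (fun k => star (v k)) (A := A)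
    (by simpa using hA)
  have hstar : ∀ k, ((star (v k) : lp (fun _ : ι => ℂ) 2) : ι → ℂ) = star ⇑(v k) :=
    fun k => lp.coeFn_star _
  have hb : ∀ (S : Finset ι) k,
      ‖(s k : ℂ) • Φ (fockProj S (u k)) (fockProj S (star ⇑(v k)))‖ ≤ s k := by
    intro S k
    rw [norm_smul, Complex.norm_real, Real.norm_of_nonneg (hs k)]
    refine mul_le_of_le_one_right (hs k) ((hΦ _ _).trans ?_)
    refine mul_le_one₀ ((norm_fockProj_le S (u k)).trans (hu k)) (norm_nonneg _) ?_
    rw [← hstar]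
    refine (norm_fockProj_le S (star (v k))).trans ?_
    rw [norm_star]; exact hv k
  refine ⟨fun S => ?_, ∑' k, (s k : ℂ) • Φ (u k) (star (v k)), ?_⟩
  · rw [← (hH S).tsum_eq]
    exact (tsum_of_norm_bounded hsum.hasSum (hb S)).trans hK
  · have : linTrunc (fun m n => Φ (lp.single 2 m 1) (lp.single 2 n 1)) A =
        fun S => ∑' k, (s k : ℂ) • Φ (fockProj S (u k)) (fockProj S (star ⇑(v k))) :=
      funext fun S => ((hH S).tsum_eq).symm
    rw [this]
    refine tendsto_tsum_of_dominated_convergence hsum (fun k => ?_)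
      (Eventually.of_forall fun S k => hb S k)
    refine Tendsto.const_smul ?_ _
    have h1 := tendsto_fockProj (u k)
    have h2 := tendsto_fockProj (star (v k))
    rw [hstar] at h2
    exact (Φ.isBoundedBilinearMap.continuous.tendsto (u k, star (v k))).comp (h1.prodMk_nhds h2)

/-- Enlarging the truncation of a positive semidefinite matrix from `s` to `t` moves the image by
at most `2 √(tr P_t A) √(tr P_{t ∖ s} A)`. -/
theorem norm_linTrunc_sub_le {A : Matrix ι ι ℂ} (hA : A.PosSemidef) {s t : Finset ι} (hst : s ⊆ t) :
    ‖linTrunc (fun m n => Φ (lp.single 2 m 1) (lp.single 2 n 1)) A t -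
        linTrunc (fun m n => Φ (lp.single 2 m 1) (lp.single 2 n 1)) A s‖ ≤
      2 * (√(∑ n ∈ t, (A n n).re) * √(∑ n ∈ t \ s, (A n n).re)) := by
  -- a Gram decomposition of the finite block `t`
  obtain ⟨w, hw⟩ : ∃ w : t → ι → ℂ, ∀ m ∈ t, ∀ n ∈ t,
      A m n = ∑ k, conj (w k m) * w k n := by
    have h1 : (A.submatrix (fun i : t => (i : ι)) (fun i : t => (i : ι))).PosSemidef :=
      hA.submatrix _
    obtain ⟨B, hB⟩ : ∃ B : Matrix t t ℂ,
        A.submatrix (fun i : t => (i : ι)) (fun i : t => (i : ι)) = star B * B := by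
      open scoped MatrixOrder in
      exact CStarAlgebra.nonneg_iff_eq_star_mul_self.mp (Matrix.nonneg_iff_posSemidef.mpr h1)
    refine ⟨fun k m => if h : m ∈ t then B k ⟨m, h⟩ else 0, fun m hm n hn => ?_⟩
    have := congrFun (congrFun hB ⟨m, hm⟩) ⟨n, hn⟩
    simpa [Matrix.mul_apply, Matrix.star_eq_conjTranspose, hm, hn] using this
  have hexp : ∀ S ⊆ t, linTrunc (fun m n => Φ (lp.single 2 m 1) (lp.single 2 n 1)) A S =
      ∑ k : t, Φ (fockProj S (fun m => conj (w k m))) (fockProj S (w k)) := by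
    intro S hS
    simp only [bilin_fockProj, linTrunc]
    symm
    rw [Finset.sum_comm]
    refine Finset.sum_congr rfl fun m hm => ?_
    rw [Finset.sum_comm]
    refine Finset.sum_congr rfl fun n hn => ?_
    rw [hw m (hS hm) n (hS hn), Finset.sum_smul]
  have hdiag : ∀ S ⊆ t, ∑ n ∈ S, (A n n).re = ∑ k : t, ‖fockProj S (w k)‖ ^ 2 := by
    intro S hS
    simp only [norm_fockProj_sq]
    symm
    rw [Finset.sum_comm]
    refine Finset.sum_congr rfl fun n hn => ?_
    rw [hw n (hS hn) n (hS hn), Complex.re_sum]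
    refine Finset.sum_congr rfl fun k _ => ?_
    rw [← Complex.normSq_eq_norm_sq, ← Complex.normSq_eq_conj_mul_self, Complex.ofReal_re]
  have hconj : ∀ S (k : t), ‖fockProj S (fun m => conj (w k m))‖ = ‖fockProj S (w k)‖ := by
    intro S k
    rw [← sq_eq_sq₀ (norm_nonneg _) (norm_nonneg _), norm_fockProj_sq, norm_fockProj_sq]
    simp
  have hsplit : ∀ u : ι → ℂ, fockProj t u = fockProj s u + fockProj (t \ s) u := by
    intro u
    unfold fockProj
    rw [add_comm, Finset.sum_sdiff hst]
  have hmono : ∀ k : t, ‖fockProj s (w k)‖ ≤ ‖fockProj t (w k)‖ := by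
    intro k
    rw [← sq_le_sq₀ (norm_nonneg _) (norm_nonneg _), norm_fockProj_sq, norm_fockProj_sq]
    exact Finset.sum_le_sum_of_subset_of_nonneg hst fun _ _ _ => by positivity
  rw [hexp t subset_rfl, hexp s hst, ← Finset.sum_sub_distrib, hdiag t subset_rfl,
    hdiag _ Finset.sdiff_subset]
  calc _ ≤ ∑ k, 2 * (‖fockProj t (w k)‖ * ‖fockProj (t \ s) (w k)‖) := by
        refine norm_sum_le_of_le _ fun k _ => ?_
        have : Φ (fockProj t (fun m => conj (w k m))) (fockProj t (w k)) -
            Φ (fockProj s (fun m => conj (w k m))) (fockProj s (w k)) =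
            Φ (fockProj (t \ s) (fun m => conj (w k m))) (fockProj t (w k)) +
            Φ (fockProj s (fun m => conj (w k m))) (fockProj (t \ s) (w k)) := by
          rw [hsplit (fun m => conj (w k m)), hsplit (w k)]
          simp only [map_add, add_apply]
          abel
        rw [this]
        refine (norm_add_le _ _).trans ?_
        have h1 := hΦ (fockProj (t \ s) (fun m => conj (w k m))) (fockProj t (w k))
        have h2 := hΦ (fockProj s (fun m => conj (w k m))) (fockProj (t \ s) (w k))
        rw [hconj] at h1 h2
        have h3 := mul_le_mul_of_nonneg_right (hmono k) (norm_nonneg (fockProj (t \ s) (w k)))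
        linarith
    _ ≤ _ := by
        rw [← Finset.mul_sum]
        gcongr
        exact Real.sum_mul_le_sqrt_mul_sqrt _ _ _

theorem exists_tendsto_linTrunc [CompleteSpace Z] {A : Matrix ι ι ℂ} (hA : A.PosSemidef)
    (htr : Summable fun n => (A n n).re) :
    ∃ z, Tendsto (linTrunc (fun m n => Φ (lp.single 2 m 1) (lp.single 2 n 1)) A) atTop (𝓝 z) := by
  have h0 : ∀ n, 0 ≤ (A n n).re := fun n => (Complex.nonneg_iff.mp hA.diag_nonneg).1
  refine cauchySeq_tendsto_of_complete ?_
  set B := ∑' n, (A n n).re with hB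
  rw [Metric.cauchySeq_iff']
  intro ε hε
  -- beyond `s`, the remaining trace is below `η`, where `2 √B √η < ε`
  set η := (ε / (2 * (√B + 1))) ^ 2 with hη
  have hBpos : 0 < 2 * (√B + 1) := by positivity
  have hη0 : 0 < η := by positivity
  obtain ⟨s, hs⟩ := summable_iff_vanishing_norm.mp htr η hη0
  refine ⟨s, fun t hst => ?_⟩
  rw [dist_eq_norm]
  refine (norm_linTrunc_sub_le hΦ hA hst).trans_lt ?_
  have h1 : √(∑ n ∈ t, (A n n).re) ≤ √B := Real.sqrt_le_sqrt (htr.sum_le_tsum _ fun n _ => h0 n)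
  have h2 : √(∑ n ∈ t \ s, (A n n).re) ≤ ε / (2 * (√B + 1)) := by
    rw [Real.sqrt_le_left (by positivity), ← hη]
    exact (le_abs_self _).trans (hs _ Finset.sdiff_disjoint).le
  calc _ ≤ 2 * (√B * (ε / (2 * (√B + 1)))) := by gcongr
    _ = ε * (√B / (√B + 1)) := by field_simp
    _ < ε * 1 := by
        refine mul_lt_mul_of_pos_left ?_ hε
        rw [div_lt_one (by positivity)]
        linarith
    _ = ε := mul_one _

end Truncation

/-! ### Born densities -/

section BornDensity

variable {ι X : Type*} [MeasurableSpace X] {vol : Measure X} {ψ : ι → X → ℂ} {A : Matrix ι ι ℂ}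

/-- The resolution of the identity says that the amplitudes are orthonormal in `L²`. -/
theorem orthonormal_toLp [DecidableEq ι] (hψ : ∀ n, MemLp (ψ n) 2 vol)
    (hres : ∀ m n, ∫ μ, ψ m μ * conj (ψ n μ) ∂vol = if m = n then 1 else 0) :
    Orthonormal ℂ fun n => (hψ n).toLp := by
  rw [orthonormal_iff_ite]
  intro m n
  rw [L2.inner_def]
  trans ∫ μ, ψ n μ * conj (ψ m μ) ∂vol
  · refine integral_congr_ae ?_
    filter_upwards [(hψ m).coeFn_toLp, (hψ n).coeFn_toLp] with μ h1 h2
    rw [h1, h2]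
    rfl
  · rw [hres]
    simp [eq_comm]

/-- The sesquilinear map `(u, v) ↦ ⟨μ|u⟩⟨v|μ⟩` from `ℓ²` to `L¹`, made bilinear by a conjugation of
`v`. -/
theorem exists_bilin_L1 [DecidableEq ι] (hψ : ∀ n, MemLp (ψ n) 2 vol)
    (hres : ∀ m n, ∫ μ, ψ m μ * conj (ψ n μ) ∂vol = if m = n then 1 else 0) :
    ∃ Φ : lp (fun _ : ι => ℂ) 2 →L[ℂ] lp (fun _ : ι => ℂ) 2 →L[ℂ] Lp ℂ 1 vol,
      (∀ u v, ‖Φ u v‖ ≤ ‖u‖ * ‖v‖) ∧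
      ∀ m n, Φ (lp.single 2 m 1) (lp.single 2 n 1) =ᵐ[vol] fun μ => conj (ψ m μ) * ψ n μ := by
  have hψ' : ∀ n, MemLp (fun μ => conj (ψ n μ)) 2 vol := fun n => (hψ n).star
  have hres' : ∀ m n, ∫ μ, conj (ψ m μ) * conj (conj (ψ n μ)) ∂vol = if m = n then 1 else 0 := by
    intro m n
    have := hres n m
    simp only [Complex.conj_conj]
    rw [show (fun μ => conj (ψ m μ) * ψ n μ) = fun μ => ψ n μ * conj (ψ m μ) from
      funext fun μ => mul_comm _ _, this]
    simp [eq_comm]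
  have o1 := orthonormal_toLp hψ' hres'
  have o2 := orthonormal_toLp hψ hres
  refine ⟨((ContinuousLinearMap.mul ℂ ℂ).holderL vol 2 2 1).bilinearComp
    o1.orthogonalFamily.linearIsometry.toContinuousLinearMap
    o2.orthogonalFamily.linearIsometry.toContinuousLinearMap, fun u v => ?_, fun m n => ?_⟩
  · have := ContinuousLinearMap.norm_holder_apply_apply_le (r := 1) (ContinuousLinearMap.mul ℂ ℂ)
      (o1.orthogonalFamily.linearIsometry u) (o2.orthogonalFamily.linearIsometry v)
    simpa using this
  · have h1 : o1.orthogonalFamily.linearIsometry (lp.single 2 m 1) = (hψ' m).toLp := by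
      simp [OrthogonalFamily.linearIsometry_apply_single]
    have h2 : o2.orthogonalFamily.linearIsometry (lp.single 2 n 1) = (hψ n).toLp := by
      simp [OrthogonalFamily.linearIsometry_apply_single]
    have h3 := ContinuousLinearMap.coeFn_holder (r := 1) (ContinuousLinearMap.mul ℂ ℂ)
      ((hψ' m).toLp) ((hψ n).toLp)
    simp only [ContinuousLinearMap.bilinearComp_apply, LinearIsometry.coe_toContinuousLinearMap,
      h1, h2, ContinuousLinearMap.holderL_apply_apply]
    filter_upwards [h3, (hψ' m).coeFn_toLp, (hψ n).coeFn_toLp] with μ e1 e2 e3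
    rw [e1, e2, e3]
    rfl

theorem coeFn_linTrunc {e : ι → ι → Lp ℂ 1 vol}
    (he : ∀ m n, e m n =ᵐ[vol] fun μ => conj (ψ m μ) * ψ n μ) (A : Matrix ι ι ℂ) (s : Finset ι) :
    ⇑(linTrunc e A s) =ᵐ[vol] bornTrunc ψ A s := by
  have h : ∀ᵐ μ ∂vol, ∀ m ∈ s, ∀ n ∈ s, (A m n • e m n) μ = conj (ψ m μ) * A m n * ψ n μ := by
    rw [eventually_all_finset]
    intro m _
    rw [eventually_all_finset]
    intro n _
    filter_upwards [he m n, Lp.coeFn_smul (A m n) (e m n)] with μ h1 h2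
    rw [h2, Pi.smul_apply, h1, smul_eq_mul]
    ring
  have h' : ∀ᵐ μ ∂vol, ∀ m ∈ s, (∑ n ∈ s, A m n • e m n : Lp ℂ 1 vol) μ =
      ∑ n ∈ s, (A m n • e m n) μ := by
    rw [eventually_all_finset]
    intro m _
    exact Lp.coeFn_fun_finsetSum _ _
  unfold linTrunc bornTrunc
  filter_upwards [h, h', Lp.coeFn_fun_finsetSum s fun m => ∑ n ∈ s, A m n • e m n]
    with μ h1 h2 h3
  rw [h3]
  exact Finset.sum_congr rfl fun m hm =>
    (h2 m hm).trans (Finset.sum_congr rfl fun n hn => h1 m hm n hn)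

theorem isBornDensity_of_tendsto {e : ι → ι → Lp ℂ 1 vol}
    (he : ∀ m n, e m n =ᵐ[vol] fun μ => conj (ψ m μ) * ψ n μ) {z : Lp ℂ 1 vol}
    (hz : Tendsto (linTrunc e A) atTop (𝓝 z)) : IsBornDensity vol ψ A z := by
  refine ⟨L1.integrable_coeFn z, ?_⟩
  refine (tendsto_iff_norm_sub_tendsto_zero.mp hz).congr fun s => ?_
  rw [L1.norm_eq_integral_norm, ← integral_congr_ae]
  filter_upwards [coeFn_linTrunc he A s, Lp.coeFn_sub (linTrunc e A s) z] with μ h1 h2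
  rw [h2, Pi.sub_apply, h1, norm_sub_rev]

/-- For positive semidefinite trace-class operators the function `μ ↦ ⟨μ|A|μ⟩` exists. -/
theorem IsDensityOperator.exists_isBornDensity [DecidableEq ι]
    (hψ : ∀ n, MemLp (ψ n) 2 vol)
    (hres : ∀ m n, ∫ μ, ψ m μ * conj (ψ n μ) ∂vol = if m = n then 1 else 0)
    (hA : IsDensityOperator A) : ∃ f, IsBornDensity vol ψ A f := by
  obtain ⟨Φ, hΦ, he⟩ := exists_bilin_L1 hψ hres
  obtain ⟨z, hz⟩ := exists_tendsto_linTrunc hΦ hA.posSemidef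
    (Complex.hasSum_re hA.trace_one).summable
  exact ⟨z, isBornDensity_of_tendsto he hz⟩

/-- For trace-class operators the function `μ ↦ ⟨μ|A|μ⟩` exists, and its truncations are bounded in
`L¹` by the trace norm. -/
theorem TraceNormLE.exists_isBornDensity {ψ : ℕ → X → ℂ} {A : Matrix ℕ ℕ ℂ} {K : ℝ}
    (hψ : ∀ n, MemLp (ψ n) 2 vol)
    (hres : ∀ m n, ∫ μ, ψ m μ * conj (ψ n μ) ∂vol = if m = n then 1 else 0)
    (hA : TraceNormLE A K) :
    (∃ f, IsBornDensity vol ψ A f) ∧ ∀ s, ∫ μ, ‖bornTrunc ψ A s μ‖ ∂vol ≤ K := by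
  obtain ⟨Φ, hΦ, he⟩ := exists_bilin_L1 hψ hres
  obtain ⟨s, u, v, hs, hsum, hK, hu, hv, hA⟩ := hA
  obtain ⟨hb, z, hz⟩ := linTrunc_of_traceClass hΦ s u v hs hsum hK hu hv hA
  refine ⟨⟨z, isBornDensity_of_tendsto he hz⟩, fun S => ?_⟩
  refine le_of_eq_of_le ?_ (hb S)
  rw [L1.norm_eq_integral_norm, ← integral_congr_ae]
  filter_upwards [coeFn_linTrunc he A S] with μ h1
  rw [h1]

theorem isBornDensity_bornDensity (h : ∃ f, IsBornDensity vol ψ A f) :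
    IsBornDensity vol ψ A (bornDensity vol ψ A) := by
  rw [bornDensity, dif_pos h]
  exact h.choose_spec

theorem integrable_bornDensity : Integrable (bornDensity vol ψ A) vol := by
  by_cases h : ∃ f, IsBornDensity vol ψ A f
  · exact (isBornDensity_bornDensity h).1
  · rw [bornDensity, dif_neg h]
    exact integrable_zero _ _ _

theorem integrable_conj_mul (hψ : ∀ n, MemLp (ψ n) 2 vol) (m n : ι) :
    Integrable (fun μ => conj (ψ m μ) * ψ n μ) vol :=
  (hψ m).star.integrable_mul (hψ n)

theorem integrable_bornTrunc (hψ : ∀ n, MemLp (ψ n) 2 vol) (A : Matrix ι ι ℂ) (s : Finset ι) :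
    Integrable (bornTrunc ψ A s) vol := by
  refine integrable_finsetSum _ fun m _ => integrable_finsetSum _ fun n _ => ?_
  refine ((integrable_conj_mul hψ m n).const_mul (A m n)).congr (ae_of_all _ fun μ => ?_)
  simp only
  ring

/-- The matrix elements `∫ ⟨m|μ⟩* ⟨n|μ⟩ g(μ) dμ` of the observable with symbol `g`. -/
noncomputable def symbolElem (vol : Measure X) (ψ : ι → X → ℂ) (g : X → ℂ) (m n : ι) : ℂ :=
  ∫ μ, conj (ψ m μ) * ψ n μ * g μ ∂vol

theorem integral_bornTrunc_mul (hψ : ∀ n, MemLp (ψ n) 2 vol) {g : X → ℂ} {C : ℝ}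
    (hg : AEStronglyMeasurable g vol) (hC : ∀ μ, ‖g μ‖ ≤ C) (s : Finset ι) :
    ∫ μ, bornTrunc ψ A s μ * g μ ∂vol = ∑ m ∈ s, ∑ n ∈ s, A m n * symbolElem vol ψ g m n := by
  have hint : ∀ m n, Integrable (fun μ => conj (ψ m μ) * ψ n μ * g μ) vol := fun m n =>
    (integrable_conj_mul hψ m n).mul_bdd hg (ae_of_all _ hC)
  have : ∀ μ, bornTrunc ψ A s μ * g μ =
      ∑ m ∈ s, ∑ n ∈ s, A m n * (conj (ψ m μ) * ψ n μ * g μ) := by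
    intro μ
    simp only [bornTrunc, Finset.sum_mul]
    refine Finset.sum_congr rfl fun m _ => Finset.sum_congr rfl fun n _ => by ring
  simp only [this]
  rw [integral_finsetSum _ fun m _ => integrable_finsetSum _ fun n _ =>
    (hint m n).const_mul (A m n)]
  refine Finset.sum_congr rfl fun m _ => ?_
  rw [integral_finsetSum _ fun n _ => (hint m n).const_mul (A m n)]
  refine Finset.sum_congr rfl fun n _ => ?_
  rw [integral_const_mul]
  rfl

/-- `∫ ⟨μ|A|μ⟩ g(μ) dμ` is the limit of the finite sums of matrix elements. -/
theorem IsBornDensity.tendsto_sum {f : X → ℂ} (hf : IsBornDensity vol ψ A f)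
    (hψ : ∀ n, MemLp (ψ n) 2 vol) {g : X → ℂ} {C : ℝ}
    (hg : AEStronglyMeasurable g vol) (hC : ∀ μ, ‖g μ‖ ≤ C) :
    Tendsto (fun s : Finset ι => ∑ m ∈ s, ∑ n ∈ s, A m n * symbolElem vol ψ g m n) atTop
      (𝓝 (∫ μ, f μ * g μ ∂vol)) := by
  rw [tendsto_iff_norm_sub_tendsto_zero]
  have h0 := hf.2.mul_const C
  rw [zero_mul] at h0
  refine squeeze_zero (fun _ => norm_nonneg _) (fun s => ?_) h0
  have hd : Integrable (fun μ => f μ - bornTrunc ψ A s μ) vol :=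
    hf.1.sub (integrable_bornTrunc hψ A s)
  rw [← integral_bornTrunc_mul hψ hg hC, norm_sub_rev,
    ← integral_sub (hf.1.mul_bdd hg (ae_of_all _ hC))
      ((integrable_bornTrunc hψ A s).mul_bdd hg (ae_of_all _ hC)), ← integral_mul_const]
  refine norm_integral_le_of_norm_le (hd.norm.mul_const C) (ae_of_all _ fun μ => ?_)
  rw [← sub_mul, norm_mul]
  exact mul_le_mul_of_nonneg_left (hC μ) (norm_nonneg _)

/-- The finite sums of matrix elements are bounded by the trace norm times a bound on the symbol. -/
theorem TraceNormLE.norm_sum_le {ψ : ℕ → X → ℂ} {A : Matrix ℕ ℕ ℂ} {K : ℝ}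
    (hψ : ∀ n, MemLp (ψ n) 2 vol)
    (hres : ∀ m n, ∫ μ, ψ m μ * conj (ψ n μ) ∂vol = if m = n then 1 else 0)
    (hA : TraceNormLE A K) {g : X → ℂ} {C : ℝ} (hC0 : 0 ≤ C)
    (hg : AEStronglyMeasurable g vol) (hC : ∀ μ, ‖g μ‖ ≤ C) (s : Finset ℕ) :
    ‖∑ m ∈ s, ∑ n ∈ s, A m n * symbolElem vol ψ g m n‖ ≤ K * C := by
  rw [← integral_bornTrunc_mul hψ hg hC]
  refine (norm_integral_le_of_norm_le ((integrable_bornTrunc hψ A s).norm.mul_const C)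
    (ae_of_all _ fun μ => ?_)).trans ?_
  · rw [norm_mul]
    exact mul_le_mul_of_nonneg_left (hC μ) (norm_nonneg _)
  · rw [integral_mul_const]
    exact mul_le_mul_of_nonneg_right ((hA.exists_isBornDensity hψ hres).2 s) hC0

/-- The function `μ ↦ ⟨μ|A|μ⟩` of a positive semidefinite `A` is real and nonnegative. -/
theorem IsBornDensity.nonneg [Countable ι] {f : X → ℂ} (hf : IsBornDensity vol ψ A f)
    (hψ : ∀ n, MemLp (ψ n) 2 vol) (hA : A.PosSemidef) : 0 ≤ᵐ[vol] f := by
  have hpos : ∀ (s : Finset ι) μ, 0 ≤ bornTrunc ψ A s μ := by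
    classical
    intro s μ
    have h := (hA.submatrix (fun i : s => (i : ι))).dotProduct_mulVec_nonneg fun i => ψ i μ
    convert h using 1
    simp only [bornTrunc, dotProduct, Matrix.mulVec, Pi.star_apply, Matrix.submatrix_apply,
      Finset.mul_sum, mul_assoc]
    rw [← Finset.sum_coe_sort s]
    refine Finset.sum_congr rfl fun m _ => ?_
    rw [← Finset.sum_coe_sort s]
    rfl
  -- an `L¹`-convergent net has an a.e. convergent subsequence
  have hmeas : ∀ s, AEStronglyMeasurable (bornTrunc ψ A s) vol := fun s =>
    (integrable_bornTrunc hψ A s).aestronglyMeasurable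
  have hL1 : Tendsto (fun s => eLpNorm (bornTrunc ψ A s - f) 1 vol) atTop (𝓝 0) := by
    have h2 := ENNReal.tendsto_ofReal hf.2
    rw [ENNReal.ofReal_zero] at h2
    refine h2.congr fun s => ?_
    have h3 := ofReal_integral_norm_eq_lintegral_enorm (hf.1.sub (integrable_bornTrunc hψ A s))
    simp only [Pi.sub_apply] at h3
    rw [eLpNorm_one_eq_lintegral_enorm, h3]
    refine lintegral_congr fun μ => ?_
    rw [Pi.sub_apply, enorm_sub_rev]
  obtain ⟨ns, -, hns⟩ := (tendstoInMeasure_of_tendsto_eLpNorm one_ne_zero hmeas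
    hf.1.aestronglyMeasurable hL1).exists_seq_tendsto_ae'
  filter_upwards [hns] with μ hμ
  exact ge_of_tendsto' hμ fun k => hpos _ μ

end BornDensity

/-! ### Operator norms, outcome laws and reconstruction -/

section OperatorNorm

variable {m n : Type*} [Fintype m] [Fintype n] [DecidableEq n]

theorem sum_norm_mulVec_sq_le (A : Matrix m n ℂ) (x : n → ℂ) :
    ∑ a, ‖∑ b, A a b * x b‖ ^ 2 ≤ ‖A‖ ^ 2 * ∑ b, ‖x b‖ ^ 2 := by
  have h := pow_le_pow_left₀ (norm_nonneg _) (Matrix.l2_opNorm_mulVec A (WithLp.toLp 2 x)) 2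
  rw [mul_pow, EuclideanSpace.norm_sq_eq, EuclideanSpace.norm_sq_eq] at h
  simpa [Matrix.mulVec, dotProduct] using h

theorem l2_opNorm_le_of_sum_sq (A : Matrix m n ℂ) {C : ℝ} (hC : 0 ≤ C)
    (h : ∀ x : n → ℂ, ∑ a, ‖∑ b, A a b * x b‖ ^ 2 ≤ C ^ 2 * ∑ b, ‖x b‖ ^ 2) : ‖A‖ ≤ C := by
  rw [Matrix.l2_opNorm_def]
  refine ContinuousLinearMap.opNorm_le_bound _ hC fun x => ?_
  refine le_of_sq_le_sq ?_ (by positivity)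
  rw [mul_pow, EuclideanSpace.norm_sq_eq, EuclideanSpace.norm_sq_eq]
  simpa [Matrix.mulVec, dotProduct] using h x

theorem sum_norm_col_sq_le (A : Matrix m n ℂ) (b : n) : ∑ a, ‖A a b‖ ^ 2 ≤ ‖A‖ ^ 2 := by
  have := sum_norm_mulVec_sq_le A (Pi.single b 1)
  simpa [Pi.single_apply, apply_ite norm, ite_pow] using this

theorem norm_entry_le_l2_opNorm (A : Matrix m n ℂ) (a : m) (b : n) : ‖A a b‖ ≤ ‖A‖ := by
  refine le_of_sq_le_sq ?_ (norm_nonneg _)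
  exact (Finset.single_le_sum (f := fun a => ‖A a b‖ ^ 2) (fun _ _ => by positivity)
    (Finset.mem_univ a)).trans (sum_norm_col_sq_le A b)

theorem sum_norm_sq_le_card_mul (A : Matrix m n ℂ) :
    ∑ a, ∑ b, ‖A a b‖ ^ 2 ≤ Fintype.card n * ‖A‖ ^ 2 := by
  rw [Finset.sum_comm, ← nsmul_eq_mul]
  exact Finset.sum_le_card_nsmul _ _ _ fun b _ => sum_norm_col_sq_le A b

theorem l2_opNorm_sq_le_sum (A : Matrix m n ℂ) : ‖A‖ ^ 2 ≤ ∑ a, ∑ b, ‖A a b‖ ^ 2 := by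
  have h0 : 0 ≤ ∑ a, ∑ b, ‖A a b‖ ^ 2 := by positivity
  have h : ‖A‖ ≤ √(∑ a, ∑ b, ‖A a b‖ ^ 2) := by
    refine l2_opNorm_le_of_sum_sq A (Real.sqrt_nonneg _) fun x => ?_
    rw [Real.sq_sqrt h0, Finset.sum_mul]
    refine Finset.sum_le_sum fun a _ => ?_
    refine (pow_le_pow_left₀ (norm_nonneg _) (norm_sum_le _ _) 2).trans ?_
    simp only [norm_mul]
    exact Finset.sum_mul_sq_le_sq_mul_sq _ _ _
  calc ‖A‖ ^ 2 ≤ √(∑ a, ∑ b, ‖A a b‖ ^ 2) ^ 2 := by gcongr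
    _ = _ := Real.sq_sqrt h0

/-- The operator norm of a tensor product is at most the product of the operator norms: apply the
factors one at a time. -/
theorem norm_tensorOp_le {κ : Type*} [Fintype κ] [DecidableEq κ] :
    ∀ {M : ℕ} (A : Fin M → Matrix κ κ ℂ), ‖tensorOp A‖ ≤ ∏ i, ‖A i‖ := by
  intro M A
  refine l2_opNorm_le_of_sum_sq _ (Finset.prod_nonneg fun _ _ => norm_nonneg _) ?_
  induction M with
  | zero =>
    intro x
    simp [tensorOp]
  | succ M ih =>
    intro x
    have e : ∀ f : (Fin (M + 1) → κ) → ℝ, ∑ a, f a = ∑ a', ∑ a₀, f (Fin.cons a₀ a') := by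
      intro f
      rw [← (Fin.consEquiv fun _ : Fin (M + 1) => κ).sum_comp, Fintype.sum_prod_type_right]
      rfl
    have e' : ∀ f : (Fin (M + 1) → κ) → ℂ, ∑ a, f a = ∑ a₀, ∑ a', f (Fin.cons a₀ a') := by
      intro f
      rw [← (Fin.consEquiv fun _ : Fin (M + 1) => κ).sum_comp, Fintype.sum_prod_type]
      rfl
    set z : κ → (Fin M → κ) → ℂ := fun b₀ a' =>
      ∑ b', tensorOp (fun i => A i.succ) a' b' * x (Fin.cons b₀ b') with hz
    calc ∑ a, ‖∑ b, tensorOp A a b * x b‖ ^ 2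
        = ∑ a', ∑ a₀, ‖∑ b₀, A 0 a₀ b₀ * z b₀ a'‖ ^ 2 := by
          rw [e]
          simp only [e', hz, tensorOp, Matrix.of_apply, Fin.prod_univ_succ, Fin.cons_zero,
            Fin.cons_succ, Finset.mul_sum, mul_assoc]
      _ ≤ ∑ a', ‖A 0‖ ^ 2 * ∑ b₀, ‖z b₀ a'‖ ^ 2 :=
          Finset.sum_le_sum fun a' _ => sum_norm_mulVec_sq_le (A 0) fun b₀ => z b₀ a'
      _ = ‖A 0‖ ^ 2 * ∑ b₀, ∑ a', ‖z b₀ a'‖ ^ 2 := by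
          rw [← Finset.mul_sum, Finset.sum_comm]
      _ ≤ ‖A 0‖ ^ 2 * ∑ b₀, ((∏ i : Fin M, ‖A i.succ‖) ^ 2 *
            ∑ b', ‖x (Fin.cons b₀ b')‖ ^ 2) := by
          gcongr with b₀
          exact ih (fun i => A i.succ) fun b' => x (Fin.cons b₀ b')
      _ = _ := by
          rw [e fun b => ‖x b‖ ^ 2, ← Finset.mul_sum, Fin.prod_univ_succ, Finset.sum_comm]
          ring

theorem tensorOp_pow_two {κ : Type*} [Fintype κ] [DecidableEq κ] {M : ℕ}
    (A : Fin M → Matrix κ κ ℂ) : tensorOp A ^ 2 = tensorOp fun i => A i ^ 2 := by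
  ext a b
  simp only [sq, Matrix.mul_apply, tensorOp, Matrix.of_apply, ← Finset.prod_mul_distrib]
  rw [Finset.prod_univ_sum, Fintype.piFinset_univ]

theorem isHermitian_tensorOp {κ : Type*} {M : ℕ} {A : Fin M → Matrix κ κ ℂ}
    (hA : ∀ i, (A i).IsHermitian) : (tensorOp A).IsHermitian := by
  ext a b
  simp only [Matrix.conjTranspose_apply, tensorOp, Matrix.of_apply, star_prod]
  exact Finset.prod_congr rfl fun i _ => (hA i).apply _ _

end OperatorNorm

section Outcome

variable {ι X : Type*} [DecidableEq ι] [Countable ι] [MeasurableSpace X] {vol : Measure X}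
  {ψ : ι → X → ℂ}

/-- Expectations over the outcomes of the measurement on `ρ` are integrals against `⟨μ|ρ|μ⟩`. -/
theorem integral_outcomeLaw (hψ : ∀ n, MemLp (ψ n) 2 vol)
    (hres : ∀ m n, ∫ μ, ψ m μ * conj (ψ n μ) ∂vol = if m = n then 1 else 0)
    {ρ : Matrix ι ι ℂ} (hρ : IsDensityOperator ρ) (g : X → ℂ) :
    ∫ μ, g μ ∂(outcomeLaw vol ψ ρ) = ∫ μ, bornDensity vol ψ ρ μ * g μ ∂vol := by
  have hB := isBornDensity_bornDensity (hρ.exists_isBornDensity hψ hres)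
  have hnn := hB.nonneg hψ hρ.posSemidef
  rw [outcomeLaw, integral_withDensity_eq_integral_toReal_smul₀]
  · refine integral_congr_ae ?_
    filter_upwards [hnn] with μ hμ
    obtain ⟨h1, h2⟩ := Complex.nonneg_iff.mp hμ
    rw [ENNReal.toReal_ofReal h1, Complex.real_smul]
    congr 1
    exact Complex.ext (by simp) (by simpa using h2)
  · exact (Complex.measurable_re.comp_aemeasurable hB.1.aemeasurable).ennreal_ofReal
  · exact ae_of_all _ fun μ => ENNReal.ofReal_lt_top

end Outcome

section Protocol

variable {N : ℕ} {X : Type*} [MeasurableSpace X] {vol : Measure X} {ψ : ℕ → X → ℂ}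
  {σ : X → Matrix (Fin N) (Fin N) ℂ}

theorem isDensityOperator_pure (s : Finset ℕ) (w : ℕ → ℂ) (hs : ∀ n ∉ s, w n = 0)
    (hw : 0 < ∑ n ∈ s, ‖w n‖ ^ 2) :
    IsDensityOperator (((∑ n ∈ s, ‖w n‖ ^ 2 : ℝ) : ℂ)⁻¹ • Matrix.vecMulVec w (star w)) := by
  constructor
  · refine Matrix.PosSemidef.smul ⟨?_, fun x => ?_⟩ ?_
    · ext i j
      simp [Matrix.vecMulVec_apply, mul_comm]
    · have : (x.sum fun i xi => x.sum fun j xj => star xi * Matrix.vecMulVec w (star w) i j * xj) =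
          (x.sum fun i xi => star xi * w i) * star (x.sum fun i xi => star xi * w i) := by
        simp only [Finsupp.sum, star_sum, Finset.sum_mul_sum, Matrix.vecMulVec_apply, star_mul',
          star_star, Pi.star_apply]
        refine Finset.sum_congr rfl fun i _ => Finset.sum_congr rfl fun j _ => by ring
      rw [this]
      exact mul_star_self_nonneg _
    · rw [inv_nonneg]
      exact_mod_cast hw.le
  · have : ∑ n ∈ s, (((∑ n ∈ s, ‖w n‖ ^ 2 : ℝ) : ℂ)⁻¹ • Matrix.vecMulVec w (star w)) n n = 1 := by
      simp only [Matrix.smul_apply, smul_eq_mul, ← Finset.mul_sum]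
      rw [show ∑ n ∈ s, Matrix.vecMulVec w (star w) n n = ((∑ n ∈ s, ‖w n‖ ^ 2 : ℝ) : ℂ) from ?_]
      · exact inv_mul_cancel₀ (by exact_mod_cast hw.ne')
      · rw [Complex.ofReal_sum]
        refine Finset.sum_congr rfl fun n _ => ?_
        rw [Matrix.vecMulVec_apply, Pi.star_apply, ← Complex.normSq_eq_norm_sq]
        exact Complex.mul_conj _
    rw [← this]
    exact hasSum_sum_of_ne_finset_zero fun n hn => by simp [Matrix.vecMulVec_apply, hs n hn]

theorem IsShadowProtocol.exists_entry_ne_zero (hN : 0 < N) (h : IsShadowProtocol N vol ψ σ) :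
    ∃ μ j k, σ μ j k ≠ 0 := by
  by_contra! hc
  have h1 := h.reconstruct _ (isDensityOperator_pure {0} (Pi.single 0 1)
    (fun n hn => by simp at hn; simp [hn]) (by simp)) ⟨0, hN⟩ ⟨0, hN⟩
  simp [hc, Matrix.vecMulVec_apply] at h1

/-- The reconstruction property on matrix units, obtained from pure states by polarization. -/
theorem IsShadowProtocol.symbolElem_eq (h : IsShadowProtocol N vol ψ σ) {C : ℝ}
    (hC : ∀ μ j k, ‖σ μ j k‖ ≤ C) (j k : Fin N) (m n : ℕ) :
    symbolElem vol ψ (fun μ => σ μ j k) m n = if m = j ∧ n = k then 1 else 0 := by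
  set G := symbolElem vol ψ (fun μ => σ μ j k) with hG
  -- both sides define the same quadratic form
  have key : ∀ (s : Finset ℕ) (w : ℕ → ℂ), (∀ n ∉ s, w n = 0) →
      ∑ m ∈ s, ∑ n ∈ s, w m * conj (w n) * G m n = w j * conj (w k) := by
    intro s w hs
    by_cases hw : ∑ n ∈ s, ‖w n‖ ^ 2 = 0
    · rw [Finset.sum_eq_zero_iff_of_nonneg fun _ _ => by positivity] at hw
      have h0 : ∀ n, w n = 0 := fun n => by
        by_cases hn : n ∈ s
        · simpa using hw n hn
        · exact hs n hn
      simp [h0]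
    · have hw' : 0 < ∑ n ∈ s, ‖w n‖ ^ 2 := lt_of_le_of_ne (by positivity) (Ne.symm hw)
      set r : ℂ := ((∑ n ∈ s, ‖w n‖ ^ 2 : ℝ) : ℂ) with hr
      have hr0 : r ≠ 0 := by rw [hr]; exact_mod_cast hw
      have hτ := isDensityOperator_pure s w hs hw'
      have hlim := (isBornDensity_bornDensity
        (hτ.exists_isBornDensity h.amp_memLp h.resolution)).tendsto_sum h.amp_memLp
        (h.snapshot_measurable j k).aestronglyMeasurable fun μ => hC μ j k
      rw [h.reconstruct _ hτ j k] at hlim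
      have hev : ∀ᶠ t : Finset ℕ in atTop, ∑ m ∈ t, ∑ n ∈ t,
          (r⁻¹ • Matrix.vecMulVec w (star w)) m n * G m n =
          r⁻¹ * ∑ m ∈ s, ∑ n ∈ s, w m * conj (w n) * G m n := by
        filter_upwards [eventually_ge_atTop s] with t hst
        rw [← Finset.sum_subset hst fun m _ hm => by simp [Matrix.vecMulVec_apply, hs m hm],
          Finset.mul_sum]
        refine Finset.sum_congr rfl fun m _ => ?_
        rw [← Finset.sum_subset hst fun n _ hn => by simp [Matrix.vecMulVec_apply, hs n hn],
          Finset.mul_sum]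
        refine Finset.sum_congr rfl fun n _ => ?_
        simp only [Matrix.smul_apply, Matrix.vecMulVec_apply, smul_eq_mul, Pi.star_apply]
        rw [← starRingEnd_apply]
        ring
      have := tendsto_nhds_unique (hlim.congr' hev) tendsto_const_nhds
      simp only [Matrix.smul_apply, Matrix.vecMulVec_apply, smul_eq_mul, Pi.star_apply] at this
      exact (mul_left_cancel₀ (inv_ne_zero hr0) this).symm
  have hdiag : ∀ m, G m m = (if (j : ℕ) = m then 1 else 0) * (if (k : ℕ) = m then 1 else 0) := by
    intro m
    have := key {m} (Pi.single m 1) fun n hn => by simp at hn; simp [hn]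
    simpa [Pi.single_apply, apply_ite conj] using this
  rw [show (if m = (j : ℕ) ∧ n = (k : ℕ) then (1 : ℂ) else 0) =
    (if (j : ℕ) = m then 1 else 0) * (if (k : ℕ) = n then 1 else 0) by
      simp only [eq_comm (a := m), eq_comm (a := n), ite_and, ite_mul, one_mul, zero_mul]]
  by_cases hmn : m = n
  · subst hmn; exact hdiag m
  have key2 : ∀ z : ℂ, G m m + conj z * G m n + z * G n m + z * conj z * G n n =
      ((if (j : ℕ) = m then 1 else 0) + z * (if (j : ℕ) = n then 1 else 0)) *
      ((if (k : ℕ) = m then 1 else 0) + conj z * (if (k : ℕ) = n then 1 else 0)) := by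
    intro z
    have := key {m, n} (fun l => (if l = m then 1 else 0) + z * (if l = n then 1 else 0))
      fun l hl => by simp at hl; simp [hl]
    rw [Finset.sum_pair hmn, Finset.sum_pair hmn, Finset.sum_pair hmn] at this
    simp only [if_true, if_neg (Ne.symm hmn), if_neg hmn, map_add, map_mul, map_one,
      apply_ite conj, map_zero] at this
    rw [← this]
    ring
  have h1 := key2 1
  have h2 := key2 Complex.I
  rw [hdiag, hdiag] at h1 h2
  simp only [map_one, Complex.conj_I] at h1 h2
  have hI : Complex.I * Complex.I = -1 := Complex.I_mul_I
  generalize (if (j : ℕ) = m then (1 : ℂ) else 0) = α at *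
  generalize (if (j : ℕ) = n then (1 : ℂ) else 0) = α' at *
  generalize (if (k : ℕ) = m then (1 : ℂ) else 0) = β at *
  generalize (if (k : ℕ) = n then (1 : ℂ) else 0) = β' at *
  linear_combination 1 / 2 * h1 + Complex.I / 2 * h2 -
    1 / 2 * (-G m n + G n m + α * β' - α' * β) * hI

end Protocol

/-! ### Several modes -/

section Multimode

variable {M : ℕ} {X : Fin M → Type*} [∀ i, MeasurableSpace (X i)]
  {vol : ∀ i, Measure (X i)} [∀ i, SigmaFinite (vol i)] {ψ : ∀ i, ℕ → X i → ℂ}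

theorem memLp_prodAmp (hψ : ∀ i n, MemLp (ψ i n) 2 (vol i)) (a : Fin M → ℕ) :
    MemLp (prodAmp ψ a) 2 (Measure.pi vol) := by
  have hm : AEStronglyMeasurable (prodAmp ψ a) (Measure.pi vol) := by
    refine Finset.aestronglyMeasurable_fun_prod _ fun i _ => ?_
    exact (hψ i (a i)).1.comp_quasiMeasurePreserving (Measure.quasiMeasurePreserving_eval vol i)
  rw [memLp_two_iff_integrable_sq_norm hm]
  have h : Integrable (fun μ : ∀ i, X i => ∏ i, ‖ψ i (a i) (μ i)‖ ^ 2) (Measure.pi vol) :=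
    Integrable.fintype_prod_dep fun i =>
      (memLp_two_iff_integrable_sq_norm (hψ i (a i)).1).mp (hψ i (a i))
  simpa only [prodAmp, norm_prod, Finset.prod_pow] using h

theorem prodAmp_resolution
    (hres : ∀ i m n, ∫ μ, ψ i m μ * conj (ψ i n μ) ∂(vol i) = if m = n then 1 else 0)
    (a b : Fin M → ℕ) :
    ∫ μ, prodAmp ψ a μ * conj (prodAmp ψ b μ) ∂(Measure.pi vol) = if a = b then 1 else 0 := by
  simp only [prodAmp, map_prod, ← Finset.prod_mul_distrib]
  rw [integral_fintype_prod_eq_prod fun i μ => ψ i (a i) μ * conj (ψ i (b i) μ)]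
  simp only [hres]
  rw [Finset.prod_ite_zero]
  simp [funext_iff]

theorem symbolElem_prodAmp (g : ∀ i, X i → ℂ) (a b : Fin M → ℕ) :
    symbolElem (Measure.pi vol) (prodAmp ψ) (fun μ => ∏ i, g i (μ i)) a b =
      ∏ i, symbolElem (vol i) (ψ i) (g i) (a i) (b i) := by
  simp only [symbolElem, prodAmp, map_prod, ← Finset.prod_mul_distrib]
  exact integral_fintype_prod_eq_prod fun i μ => conj (ψ i (a i) μ) * ψ i (b i) μ * g i μ

theorem sum_piFinset_prod (S : Fin M → Finset ℕ) (h : Fin M → ℕ → ℕ → ℂ) :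
    ∑ a ∈ Fintype.piFinset S, ∑ b ∈ Fintype.piFinset S, ∏ i, h i (a i) (b i) =
      ∏ i, ∑ m ∈ S i, ∑ n ∈ S i, h i m n := by
  rw [Finset.prod_univ_sum]
  refine Finset.sum_congr rfl fun a _ => ?_
  rw [Finset.prod_univ_sum]

theorem tendsto_piFinset_range :
    Tendsto (fun n : ℕ => Fintype.piFinset fun _ : Fin M => Finset.range n) atTop atTop := by
  refine tendsto_atTop_finset_of_monotone (fun m n hmn => ?_) fun a => ?_
  · exact Fintype.piFinset_subset _ _ fun _ => Finset.range_mono hmn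
  · refine ⟨∑ i, a i + 1, ?_⟩
    simp only [Fintype.mem_piFinset, Finset.mem_range]
    intro i
    exact Nat.lt_succ_of_le (Finset.single_le_sum (f := a) (fun _ _ => Nat.zero_le _)
      (Finset.mem_univ i))

variable {ρ : Matrix (Fin M → ℕ) (Fin M → ℕ) ℂ} {g : ∀ i, X i → ℂ} {C : ℝ}

omit [∀ i, MeasurableSpace (X i)] in
theorem norm_prod_comp_le (hC : ∀ i μ, ‖g i μ‖ ≤ C) (μ : ∀ i, X i) :
    ‖∏ i, g i (μ i)‖ ≤ C ^ M := by
  rw [norm_prod]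
  refine (Finset.prod_le_prod (fun _ _ => norm_nonneg _) fun i _ => hC i (μ i)).trans ?_
  simp

theorem measurable_prod_comp (hg : ∀ i, Measurable (g i)) :
    Measurable fun μ : ∀ i, X i => ∏ i, g i (μ i) :=
  Finset.measurable_fun_prod _ fun i _ => (hg i).comp (measurable_pi_apply i)

/-- The expectation of a product observable in a state with density operator `ρ`, in terms of the
matrix elements of its factors. -/
theorem tendsto_sum_prod_symbolElem (hψ : ∀ i n, MemLp (ψ i n) 2 (vol i))
    (hres : ∀ i m n, ∫ μ, ψ i m μ * conj (ψ i n μ) ∂(vol i) = if m = n then 1 else 0)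
    (hρ : IsDensityOperator ρ) (hg : ∀ i, Measurable (g i)) (hC : ∀ i μ, ‖g i μ‖ ≤ C) :
    Tendsto (fun s : Finset (Fin M → ℕ) => ∑ a ∈ s, ∑ b ∈ s,
        ρ a b * ∏ i, symbolElem (vol i) (ψ i) (g i) (a i) (b i)) atTop
      (𝓝 (∫ μ, ∏ i, g i (μ i) ∂(outcomeLaw (Measure.pi vol) (prodAmp ψ) ρ))) := by
  rw [integral_outcomeLaw (memLp_prodAmp hψ) (prodAmp_resolution hres) hρ]
  have h := (isBornDensity_bornDensity (hρ.exists_isBornDensity (memLp_prodAmp hψ)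
    (prodAmp_resolution hres))).tendsto_sum (memLp_prodAmp hψ)
    (measurable_prod_comp hg).aestronglyMeasurable (norm_prod_comp_le hC)
  simpa only [symbolElem_prodAmp] using h

/-- The expectation of a product observable factorizes along a product expansion of `ρ`. -/
theorem hasSum_integral_prod (hψ : ∀ i n, MemLp (ψ i n) 2 (vol i))
    (hres : ∀ i m n, ∫ μ, ψ i m μ * conj (ψ i n μ) ∂(vol i) = if m = n then 1 else 0)
    (hρ : IsDensityOperator ρ) {κ : Type*} {c : κ → ℂ} {A : κ → Fin M → Matrix ℕ ℕ ℂ}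
    (hc : Summable fun α => ‖c α‖) {K : ℝ} (hA : ∀ α i, TraceNormLE (A α i) K)
    (hexp : ∀ a b, HasSum (fun α => c α * tensorOp (A α) a b) (ρ a b))
    (hC0 : 0 ≤ C) (hg : ∀ i, Measurable (g i)) (hC : ∀ i μ, ‖g i μ‖ ≤ C) :
    HasSum (fun α => c α * ∏ i, ∫ μ, bornDensity (vol i) (ψ i) (A α i) μ * g i μ ∂(vol i))
      (∫ μ, ∏ i, g i (μ i) ∂(outcomeLaw (Measure.pi vol) (prodAmp ψ) ρ)) := by
  set F : κ → Fin M → Finset ℕ → ℂ := fun α i s =>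
    ∑ m ∈ s, ∑ n ∈ s, A α i m n * symbolElem (vol i) (ψ i) (g i) m n with hF
  have hFlim : ∀ α i, Tendsto (F α i) atTop
      (𝓝 (∫ μ, bornDensity (vol i) (ψ i) (A α i) μ * g i μ ∂(vol i))) := fun α i =>
    (isBornDensity_bornDensity ((hA α i).exists_isBornDensity (hψ i) (hres i)).1).tendsto_sum
      (hψ i) (hg i).aestronglyMeasurable (hC i)
  have hFb : ∀ α i s, ‖F α i s‖ ≤ K * C := fun α i s =>
    (hA α i).norm_sum_le (hψ i) (hres i) hC0 (hg i).aestronglyMeasurable (hC i) s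
  have hprodb : ∀ α (f : Fin M → ℂ), (∀ i, ‖f i‖ ≤ K * C) →
      ‖c α * ∏ i, f i‖ ≤ ‖c α‖ * (K * C) ^ M := by
    intro α f hf
    rw [norm_mul, norm_prod]
    gcongr
    refine (Finset.prod_le_prod (fun _ _ => norm_nonneg _) fun i _ => hf i).trans ?_
    simp
  -- on a box both the matrix elements and the summation range factorize over the modes
  have hbox : ∀ n : ℕ, HasSum (fun α => c α * ∏ i, F α i (Finset.range n))
      (∑ a ∈ Fintype.piFinset fun _ => Finset.range n,
        ∑ b ∈ Fintype.piFinset fun _ => Finset.range n,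
          ρ a b * ∏ i, symbolElem (vol i) (ψ i) (g i) (a i) (b i)) := by
    intro n
    have hterm : ∀ α, c α * ∏ i, F α i (Finset.range n) =
        ∑ a ∈ Fintype.piFinset fun _ => Finset.range n,
          ∑ b ∈ Fintype.piFinset fun _ => Finset.range n,
            c α * tensorOp (A α) a b * ∏ i, symbolElem (vol i) (ψ i) (g i) (a i) (b i) := by
      intro α
      rw [hF, ← sum_piFinset_prod (fun _ => Finset.range n), Finset.mul_sum]
      refine Finset.sum_congr rfl fun a _ => ?_
      rw [Finset.mul_sum]
      refine Finset.sum_congr rfl fun b _ => ?_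
      rw [tensorOp, Matrix.of_apply, mul_assoc, Finset.prod_mul_distrib]
    simp only [hterm]
    exact hasSum_sum fun a _ => hasSum_sum fun b _ => (hexp a b).mul_right _
  have hsum := hc.mul_right ((K * C) ^ M)
  have hlim1 := (tendsto_sum_prod_symbolElem hψ hres hρ hg hC).comp tendsto_piFinset_range
  have hlim2 : Tendsto (fun n : ℕ => ∑' α, c α * ∏ i, F α i (Finset.range n)) atTop
      (𝓝 (∑' α, c α * ∏ i, ∫ μ, bornDensity (vol i) (ψ i) (A α i) μ * g i μ ∂(vol i))) := by
    refine tendsto_tsum_of_dominated_convergence hsum (fun α => ?_)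
      (Eventually.of_forall fun n α => hprodb α _ fun i => hFb α i _)
    exact (tendsto_finsetProd _ fun i _ =>
      (hFlim α i).comp tendsto_finset_range).const_mul _
  have heq : (fun n : ℕ => ∑' α, c α * ∏ i, F α i (Finset.range n)) = _ :=
    funext fun n => (hbox n).tsum_eq
  rw [heq] at hlim2
  rw [tendsto_nhds_unique hlim1 hlim2]
  refine (Summable.of_norm_bounded hsum fun α => hprodb α _ fun i => ?_).hasSum
  exact le_of_tendsto' (hFlim α i).norm fun s => hFb α i s

variable {N : ℕ} {σ : ∀ i, X i → Matrix (Fin N) (Fin N) ℂ}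

omit [∀ i, SigmaFinite (vol i)] in
/-- A uniform bound on the product snapshots bounds the snapshots of the individual modes, because
none of these vanishes identically. -/
theorem exists_snapshot_bound (hN : 0 < N) (hσ : ∀ i, IsShadowProtocol N (vol i) (ψ i) (σ i))
    {B : ℝ} (hB : ∀ μ, ‖localSnapshot σ μ‖ ≤ B) :
    ∃ C, 0 ≤ C ∧ ∀ i μ j k, ‖σ i μ j k‖ ≤ C := by
  choose μ₀ a₀ b₀ h₀ using fun i => (hσ i).exists_entry_ne_zero hN
  have hi : ∀ i, ∀ μ j k,
      ‖σ i μ j k‖ ≤ B / ∏ i' ∈ Finset.univ.erase i, ‖σ i' (μ₀ i') (a₀ i') (b₀ i')‖ := by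
    intro i μ j k
    rw [le_div_iff₀ (Finset.prod_pos fun i' _ => norm_pos_iff.mpr (h₀ i'))]
    have h := (norm_entry_le_l2_opNorm (localSnapshot σ (Function.update μ₀ i μ))
      (Function.update a₀ i j) (Function.update b₀ i k)).trans (hB _)
    rw [localSnapshot, tensorOp, Matrix.of_apply, norm_prod,
      ← Finset.mul_prod_erase _ _ (Finset.mem_univ i)] at h
    simp only [Function.update_self] at h
    convert h using 2
    refine Finset.prod_congr rfl fun i' hi' => ?_
    have hne := Finset.ne_of_mem_erase hi'
    simp only [Function.update_of_ne hne]
  refine ⟨∑ i, |B / ∏ i' ∈ Finset.univ.erase i, ‖σ i' (μ₀ i') (a₀ i') (b₀ i')‖|,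
    Finset.sum_nonneg fun _ _ => abs_nonneg _, fun i μ j k => (hi i μ j k).trans ?_⟩
  exact (le_abs_self _).trans (Finset.single_le_sum
    (f := fun i => |B / ∏ i' ∈ Finset.univ.erase i, ‖σ i' (μ₀ i') (a₀ i') (b₀ i')‖|)
    (fun _ _ => abs_nonneg _) (Finset.mem_univ i))

/-- The product snapshot is an unbiased estimator of the regularized state. -/
theorem matrixExp_localSnapshot (hσ : ∀ i, IsShadowProtocol N (vol i) (ψ i) (σ i))
    (hρ : IsDensityOperator ρ) (hC : ∀ i μ j k, ‖σ i μ j k‖ ≤ C) :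
    matrixExp (outcomeLaw (Measure.pi vol) (prodAmp ψ) ρ) (localSnapshot σ) = regularize N ρ := by
  ext a b
  simp only [matrixExp, localSnapshot, tensorOp, Matrix.of_apply, regularize]
  have h := tendsto_sum_prod_symbolElem (fun i => (hσ i).amp_memLp) (fun i => (hσ i).resolution) hρ
    (fun i => (hσ i).snapshot_measurable (a i) (b i)) fun i μ => hC i μ (a i) (b i)
  refine tendsto_nhds_unique (h.congr' ?_) tendsto_const_nhds
  set a' : Fin M → ℕ := fun i => a i with ha'
  set b' : Fin M → ℕ := fun i => b i with hb'
  have hprod : ∀ x y : Fin M → ℕ, ∏ i, symbolElem (vol i) (ψ i) (fun μ => σ i μ (a i) (b i))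
      (x i) (y i) = if x = a' ∧ y = b' then 1 else 0 := by
    intro x y
    simp only [(hσ _).symbolElem_eq (hC _)]
    rw [Finset.prod_ite_zero]
    simp [funext_iff, forall_and, ha', hb']
  -- once `s` contains both index vectors, exactly one term is nonzero
  filter_upwards [eventually_ge_atTop ({a', b'} : Finset (Fin M → ℕ))] with s hs
  have h1 : a' ∈ s := hs (by simp)
  have h2 : b' ∈ s := hs (by simp)
  simp only [hprod]
  rw [Finset.sum_eq_single_of_mem a' h1 fun x _ hx => by simp [hx],
    Finset.sum_eq_single_of_mem b' h2 fun y _ hy => by simp [hy]]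
  simp

/-- The multimode variance bound. -/
theorem norm_matrixExp_sq_le (hσ : ∀ i, IsShadowProtocol N (vol i) (ψ i) (σ i))
    (hρ : IsDensityOperator ρ) {κ : Type*} {c : κ → ℂ} {A : κ → Fin M → Matrix ℕ ℕ ℂ}
    (hc : Summable fun α => ‖c α‖) {K : ℝ} (hA : ∀ α i, TraceNormLE (A α i) K)
    (hexp : ∀ a b, HasSum (fun α => c α * tensorOp (A α) a b) (ρ a b))
    (hC0 : 0 ≤ C) (hC : ∀ i μ j k, ‖σ i μ j k‖ ≤ C) {ν₁ : ℝ}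
    (hν : ∀ α i, ‖secondMoment (vol i) (ψ i) (σ i) (A α i)‖ ≤ ν₁ ^ 2) :
    ‖matrixExp (outcomeLaw (Measure.pi vol) (prodAmp ψ) ρ) fun μ => localSnapshot σ μ ^ 2‖ ≤
      ν₁ ^ (2 * M) * ∑' α, ‖c α‖ := by
  have hmeas : ∀ i j k, Measurable fun μ => (σ i μ ^ 2) j k := by
    intro i j k
    simp only [sq, Matrix.mul_apply]
    exact Finset.measurable_fun_sum _ fun l _ =>
      ((hσ i).snapshot_measurable j l).mul ((hσ i).snapshot_measurable l k)
  have hbd : ∀ i μ j k, ‖(σ i μ ^ 2) j k‖ ≤ N * (C * C) := by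
    intro i μ j k
    simp only [sq, Matrix.mul_apply]
    refine (norm_sum_le_of_le _ fun l _ => (norm_mul_le _ _).trans
      (mul_le_mul (hC i μ j l) (hC i μ l k) (norm_nonneg _) hC0)).trans ?_
    simp
  have hsum : HasSum (fun α => c α • tensorOp fun i => secondMoment (vol i) (ψ i) (σ i) (A α i))
      (matrixExp (outcomeLaw (Measure.pi vol) (prodAmp ψ) ρ) fun μ => localSnapshot σ μ ^ 2) := by
    refine Pi.hasSum.mpr fun a => Pi.hasSum.mpr fun b => ?_
    simp only [localSnapshot, tensorOp_pow_two]
    exact hasSum_integral_prod (fun i => (hσ i).amp_memLp) (fun i => (hσ i).resolution) hρ hc hA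
      hexp (by positivity) (fun i => hmeas i (a i) (b i)) fun i μ => hbd i μ (a i) (b i)
  have hb : ∀ α, ‖c α • tensorOp fun i => secondMoment (vol i) (ψ i) (σ i) (A α i)‖ ≤
      ν₁ ^ (2 * M) * ‖c α‖ := by
    intro α
    rw [norm_smul, mul_comm, pow_mul]
    gcongr
    refine (norm_tensorOp_le _).trans ((Finset.prod_le_prod (fun _ _ => norm_nonneg _)
      fun i _ => hν α i).trans ?_)
    simp
  rw [← hsum.tsum_eq, ← tsum_mul_left]
  exact tsum_of_norm_bounded (hc.mul_left _).hasSum hb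

end Multimode

/-! ### Bernstein's inequality in a Hilbert space -/

section Scalar

/-- `u ↦ cosh √u` is convex, since its power series has nonnegative coefficients. -/
theorem cosh_sqrt_convex_comb_le {u v t : ℝ} (hu : 0 ≤ u) (hv : 0 ≤ v) (ht0 : 0 ≤ t) (ht1 : t ≤ 1) :
    Real.cosh √(t * u + (1 - t) * v) ≤ t * Real.cosh √u + (1 - t) * Real.cosh √v := by
  have hs : ∀ w : ℝ, 0 ≤ w → HasSum (fun n : ℕ => w ^ n / (2 * n).factorial) (Real.cosh √w) := by
    intro w hw
    have := Real.hasSum_cosh √w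
    simpa only [pow_mul, Real.sq_sqrt hw] using this
  have ht1' : 0 ≤ 1 - t := by linarith
  refine hasSum_le (fun n => ?_) (hs _ (by positivity))
    (((hs u hu).mul_left t).add ((hs v hv).mul_left (1 - t)))
  rw [mul_div_assoc', mul_div_assoc', ← add_div]
  gcongr
  exact (convexOn_pow n).2 hu hv ht0 ht1' (by ring)

theorem sinh_le_mul_cosh {y : ℝ} (hy : 0 ≤ y) : Real.sinh y ≤ y * Real.cosh y := by
  refine hasSum_le (fun n => ?_) (Real.hasSum_sinh y) ((Real.hasSum_cosh y).mul_left y)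
  rw [mul_div_assoc', ← pow_succ']
  gcongr
  omega

theorem exp_le_one_add_add_sq_div {x : ℝ} (hx0 : 0 ≤ x) (hx2 : x < 2) :
    Real.exp x ≤ 1 + x + x ^ 2 / (2 - x) := by
  have h2 : 0 < 2 - x := by linarith
  rw [show 1 + x + x ^ 2 / (2 - x) = (2 + x) / (2 - x) by field_simp; ring, le_div_iff₀ h2]
  -- with `y = x / 2` this is `sinh y ≤ y cosh y`
  have h := sinh_le_mul_cosh (y := x / 2) (by positivity)
  rw [Real.sinh_eq, Real.cosh_eq] at h
  have hp : Real.exp (x / 2) * Real.exp (x / 2) = Real.exp x := by rw [← Real.exp_add]; ring_nf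
  have hn : Real.exp (-(x / 2)) * Real.exp (x / 2) = 1 := by rw [← Real.exp_add]; simp
  have h3 := mul_le_mul_of_nonneg_right h (Real.exp_pos (x / 2)).le
  nlinarith [h3, hp, hn]

end Scalar

section Bernstein

variable {H : Type*} [NormedAddCommGroup H] [InnerProductSpace ℝ H]

/-- Up to a term linear in `x`, moving `s` by `x` multiplies `cosh ‖s‖` by at most
`exp ‖x‖ - ‖x‖`. By convexity of `cosh ∘ √` it suffices to compare at `x` parallel to `s`. -/
theorem cosh_norm_add_le (s x : H) :
    Real.cosh ‖s + x‖ ≤ Real.cosh ‖s‖ * (Real.exp ‖x‖ - ‖x‖) +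
      inner ℝ ((Real.sinh ‖s‖ / ‖s‖) • s) x := by
  set a := ‖s‖ with ha
  set b := ‖x‖ with hb
  set c := inner ℝ s x / (a * b) with hc
  have ha0 : 0 ≤ a := norm_nonneg _
  have hb0 : 0 ≤ b := norm_nonneg _
  have hc1 : |c| ≤ 1 := abs_real_inner_div_norm_mul_norm_le_one s x
  have hin : inner ℝ s x = a * b * c := by
    by_cases h : a * b = 0
    · have := abs_real_inner_le_norm s x
      rw [← ha, ← hb, h] at this
      rw [h, zero_mul]
      exact abs_nonpos_iff.mp this
    · rw [hc, mul_div_cancel₀ _ h]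
  obtain ⟨hcl, hcu⟩ := abs_le.mp hc1
  have hnorm : ‖s + x‖ = √((1 + c) / 2 * (a + b) ^ 2 + (1 - (1 + c) / 2) * (a - b) ^ 2) := by
    rw [← Real.sqrt_sq (norm_nonneg (s + x)), norm_add_sq_real, hin]
    congr 1
    ring
  have hconv := cosh_sqrt_convex_comb_le (sq_nonneg (a + b)) (sq_nonneg (a - b))
    (t := (1 + c) / 2) (by linarith) (by linarith)
  rw [← hnorm, Real.sqrt_sq_eq_abs, Real.sqrt_sq_eq_abs, Real.cosh_abs, Real.cosh_abs,
    Real.cosh_add, Real.cosh_sub] at hconv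
  have hsb : 0 ≤ Real.sinh b - b := sub_nonneg.mpr (Real.self_le_sinh_iff.mpr hb0)
  have hsa : 0 ≤ Real.sinh a := Real.sinh_nonneg_iff.mpr ha0
  have hca : c * Real.sinh a ≤ Real.cosh a := by
    have h1 := (Real.sinh_lt_cosh a).le
    nlinarith
  have hlin : inner ℝ ((Real.sinh a / a) • s) x = Real.sinh a * b * c := by
    rw [real_inner_smul_left, hin]
    by_cases h : a = 0
    · simp [h]
    · field_simp
  rw [hlin, ← Real.cosh_add_sinh b]
  nlinarith [mul_le_mul_of_nonneg_right hca hsb]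

variable [CompleteSpace H] [SecondCountableTopology H] [MeasurableSpace H] [BorelSpace H]
  {Ω : Type*} [MeasurableSpace Ω] {P : Measure Ω} [IsProbabilityMeasure P]
  {τ : Type*} {Y : τ → Ω → H} {b v : ℝ}

/-- Hyperbolic-cosine moments of a sum of independent centered vectors in a Hilbert space. -/
theorem integral_cosh_norm_sum_le (hY : ∀ t, AEMeasurable (Y t) P) (hind : iIndepFun Y P)
    (hb2 : b < 2) (hbd : ∀ t ω, ‖Y t ω‖ ≤ b) (hmean : ∀ t, ∫ ω, Y t ω ∂P = 0)
    (hv : ∀ t, ∫ ω, ‖Y t ω‖ ^ 2 ∂P ≤ v) (s : Finset τ) :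
    ∫ ω, Real.cosh ‖∑ t ∈ s, Y t ω‖ ∂P ≤ Real.exp (s.card * (v / (2 - b))) := by
  classical
  have h2b : 0 < 2 - b := by linarith
  induction s using Finset.induction_on with
  | empty => simp
  | insert t s ht ih =>
    set S : Ω → H := fun ω => ∑ t ∈ s, Y t ω with hS
    have hSm : AEMeasurable S P := Finset.aemeasurable_fun_sum _ fun t _ => hY t
    have hSb : ∀ ω, ‖S ω‖ ≤ s.card * b := fun ω =>
      (norm_sum_le_of_le _ fun t _ => hbd t ω).trans (by simp)
    have hSY : IndepFun S (Y t) P := by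
      have := hind.indepFun_finsetSum_of_notMem₀ hY ht
      convert this using 1
      ext ω
      simp [hS]
    have hgm : Measurable fun z : H => (Real.sinh ‖z‖ / ‖z‖) • z := by fun_prop
    have hg : Integrable (fun ω => (Real.sinh ‖S ω‖ / ‖S ω‖) • S ω) P := by
      refine Integrable.of_bound (hgm.comp_aemeasurable hSm).aestronglyMeasurable
        (Real.sinh (s.card * b)) (ae_of_all _ fun ω => ?_)
      rw [norm_smul, norm_div, norm_norm, Real.norm_of_nonneg
        (Real.sinh_nonneg_iff.mpr (norm_nonneg _))]
      refine le_trans ?_ (Real.sinh_le_sinh.mpr (hSb ω))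
      by_cases h : ‖S ω‖ = 0
      · simp [h]
      · rw [div_mul_cancel₀ _ h]
    have hYi : Integrable (Y t) P :=
      Integrable.of_bound (hY t).aestronglyMeasurable b (ae_of_all _ (hbd t))
    have hcosh : ∀ {Z : Ω → H} {B : ℝ}, AEMeasurable Z P → (∀ ω, ‖Z ω‖ ≤ B) →
        Integrable (fun ω => Real.cosh ‖Z ω‖) P := by
      intro Z B hZ hB
      have hm : Measurable fun z : H => Real.cosh ‖z‖ := by fun_prop
      refine Integrable.of_bound (hm.comp_aemeasurable hZ).aestronglyMeasurable
        (Real.cosh B) (ae_of_all _ fun ω => ?_)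
      rw [Real.norm_of_nonneg (Real.cosh_pos _).le, Real.cosh_le_cosh, abs_norm]
      exact (hB ω).trans (le_abs_self _)
    have hem : Measurable fun z : H => Real.exp ‖z‖ - ‖z‖ := by fun_prop
    have hexp1 : ∀ ω, 0 ≤ Real.exp ‖Y t ω‖ - ‖Y t ω‖ := fun ω => by
      linarith [Real.add_one_le_exp ‖Y t ω‖]
    have hexp : ∀ ω, Real.exp ‖Y t ω‖ - ‖Y t ω‖ ≤ 1 + ‖Y t ω‖ ^ 2 / (2 - b) := by
      intro ω
      have h1 := hbd t ω
      have h2 := exp_le_one_add_add_sq_div (norm_nonneg (Y t ω)) (h1.trans_lt hb2)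
      have h3 : ‖Y t ω‖ ^ 2 / (2 - ‖Y t ω‖) ≤ ‖Y t ω‖ ^ 2 / (2 - b) := by gcongr
      linarith
    have hsqi : Integrable (fun ω => ‖Y t ω‖ ^ 2) P := by
      refine Integrable.of_bound ((hY t).norm.pow_const 2).aestronglyMeasurable (b ^ 2)
        (ae_of_all _ fun ω => ?_)
      rw [Real.norm_of_nonneg (by positivity)]
      exact pow_le_pow_left₀ (norm_nonneg _) (hbd t ω) 2
    have hEi : Integrable (fun ω => Real.exp ‖Y t ω‖ - ‖Y t ω‖) P := by
      refine Integrable.mono' ((integrable_const (1 : ℝ)).add (hsqi.div_const (2 - b)))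
        (hem.comp_aemeasurable (hY t)).aestronglyMeasurable (ae_of_all _ fun ω => ?_)
      rw [Real.norm_of_nonneg (hexp1 ω)]
      exact hexp ω
    have hE : ∫ ω, (Real.exp ‖Y t ω‖ - ‖Y t ω‖) ∂P ≤ Real.exp (v / (2 - b)) := by
      calc _ ≤ ∫ ω, (1 + ‖Y t ω‖ ^ 2 / (2 - b)) ∂P :=
            integral_mono hEi ((integrable_const (1 : ℝ)).add (hsqi.div_const (2 - b))) hexp
        _ = 1 + (∫ ω, ‖Y t ω‖ ^ 2 ∂P) / (2 - b) := by
            rw [integral_add (integrable_const (1 : ℝ)) (hsqi.div_const (2 - b)),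
              integral_div]
            simp
        _ ≤ 1 + v / (2 - b) := by gcongr; exact hv t
        _ ≤ _ := by linarith [Real.add_one_le_exp (v / (2 - b))]
    have hcm : Measurable fun z : H => Real.cosh ‖z‖ := by fun_prop
    have hind1 : IndepFun (fun ω => Real.cosh ‖S ω‖) (fun ω => Real.exp ‖Y t ω‖ - ‖Y t ω‖) P :=
      hSY.comp hcm hem
    have hind2 : IndepFun (fun ω => (Real.sinh ‖S ω‖ / ‖S ω‖) • S ω) (Y t) P :=
      hSY.comp hgm measurable_id
    have hprod := hind1.integral_fun_mul_eq_mul_integral (hcosh hSm hSb).aestronglyMeasurable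
      hEi.aestronglyMeasurable
    have hin : ∫ ω, inner ℝ ((Real.sinh ‖S ω‖ / ‖S ω‖) • S ω) (Y t ω) ∂P = 0 := by
      have h := hind2.integral_bilin hg hYi (innerSL ℝ)
      rw [hmean t, map_zero] at h
      exact h
    have hini : Integrable (fun ω => inner ℝ ((Real.sinh ‖S ω‖ / ‖S ω‖) • S ω) (Y t ω)) P :=
      hind2.integrable_bilin hg hYi (innerSL ℝ)
    have hpi : Integrable (fun ω => Real.cosh ‖S ω‖ * (Real.exp ‖Y t ω‖ - ‖Y t ω‖)) P :=
      hind1.integrable_mul (hcosh hSm hSb) hEi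
    have hsum : ∀ ω, ∑ t ∈ insert t s, Y t ω = S ω + Y t ω := fun ω => by
      rw [Finset.sum_insert ht, add_comm]
    simp only [hsum]
    calc ∫ ω, Real.cosh ‖S ω + Y t ω‖ ∂P
        ≤ ∫ ω, (Real.cosh ‖S ω‖ * (Real.exp ‖Y t ω‖ - ‖Y t ω‖) +
            inner ℝ ((Real.sinh ‖S ω‖ / ‖S ω‖) • S ω) (Y t ω)) ∂P := by
          refine integral_mono ?_ (hpi.add hini) fun ω => cosh_norm_add_le _ _
          exact hcosh (hSm.add (hY t)) fun ω =>
            (norm_add_le _ _).trans (add_le_add (hSb ω) (hbd t ω))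
      _ = (∫ ω, Real.cosh ‖S ω‖ ∂P) * ∫ ω, (Real.exp ‖Y t ω‖ - ‖Y t ω‖) ∂P := by
          rw [integral_add hpi hini, hin, add_zero, hprod]
      _ ≤ Real.exp (s.card * (v / (2 - b))) * Real.exp (v / (2 - b)) :=
          mul_le_mul ih hE (integral_nonneg hexp1) (Real.exp_pos _).le
      _ = _ := by
          rw [← Real.exp_add, Finset.card_insert_of_notMem ht]
          push_cast
          ring_nf

/-- **Bernstein's inequality in a Hilbert space.** The bound does not depend on the dimension. -/
theorem measure_norm_sum_ge_le [Fintype τ] (hY : ∀ t, AEMeasurable (Y t) P) (hind : iIndepFun Y P)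
    (hb0 : 0 ≤ b) (hbd : ∀ t ω, ‖Y t ω‖ ≤ b) (hmean : ∀ t, ∫ ω, Y t ω ∂P = 0) (hv0 : 0 < v)
    (hv : ∀ t, ∫ ω, ‖Y t ω‖ ^ 2 ∂P ≤ v) {ε : ℝ} (hε : 0 < ε) :
    P.real {ω | Fintype.card τ * ε ≤ ‖∑ t, Y t ω‖} ≤
      2 * Real.exp (-(Fintype.card τ * ε ^ 2 / (2 * (v + b * ε / 2)))) := by
  set D := v + b * ε / 2 with hD
  have hD0 : 0 < D := by positivity
  -- the optimal scale in the exponential moment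
  set r := ε / D with hr
  have hr0 : 0 < r := by positivity
  set n : ℝ := (Fintype.card τ : ℝ) with hn
  have h2 : 2 - r * b = 2 * v / D := by
    rw [hr]
    field_simp
    rw [hD]
    ring
  have h2' : 0 < 2 - r * b := by rw [h2]; positivity
  have hm := integral_cosh_norm_sum_le (Y := fun t ω => r • Y t ω) (P := P) (b := r * b)
    (v := r ^ 2 * v) (fun t => (hY t).const_smul r)
    (hind.comp (fun _ z => r • z) fun _ => measurable_const_smul r) (by linarith)
    (fun t ω => by
      rw [norm_smul, Real.norm_of_nonneg hr0.le]
      exact mul_le_mul_of_nonneg_left (hbd t ω) hr0.le)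
    (fun t => by rw [integral_smul, hmean t, smul_zero])
    (fun t => by
      simp only [norm_smul, mul_pow, Real.norm_of_nonneg hr0.le]
      rw [integral_const_mul]
      exact mul_le_mul_of_nonneg_left (hv t) (by positivity)) Finset.univ
  rw [Finset.card_univ, ← hn] at hm
  simp only [← Finset.smul_sum, norm_smul, Real.norm_of_nonneg hr0.le] at hm
  have hexpo : n * (r ^ 2 * v / (2 - r * b)) = n * r * ε / 2 := by
    rw [h2, hr]
    field_simp
  have hSm : AEMeasurable (fun ω => ∑ t, Y t ω) P := Finset.aemeasurable_fun_sum _ fun t _ => hY t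
  have hcm : Measurable fun z : H => Real.cosh (r * ‖z‖) := by fun_prop
  have hint : Integrable (fun ω => Real.cosh (r * ‖∑ t, Y t ω‖)) P := by
    refine Integrable.of_bound (hcm.comp_aemeasurable hSm).aestronglyMeasurable
      (Real.cosh (r * (n * b))) (ae_of_all _ fun ω => ?_)
    rw [Real.norm_of_nonneg (Real.cosh_pos _).le, Real.cosh_le_cosh,
      abs_of_nonneg (by positivity), abs_of_nonneg (by positivity)]
    gcongr
    exact (norm_sum_le_of_le _ fun t _ => hbd t ω).trans (by simp [hn])
  have hmarkov := mul_meas_ge_le_integral_of_nonneg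
    (ae_of_all _ fun ω => (Real.cosh_pos (r * ‖∑ t, Y t ω‖)).le) hint (Real.exp (r * (n * ε)) / 2)
  have hsub : {ω | n * ε ≤ ‖∑ t, Y t ω‖} ⊆
      {ω | Real.exp (r * (n * ε)) / 2 ≤ Real.cosh (r * ‖∑ t, Y t ω‖)} := by
    intro ω hω
    have h1 : Real.exp (r * (n * ε)) ≤ Real.exp (r * ‖∑ t, Y t ω‖) :=
      Real.exp_le_exp.mpr (mul_le_mul_of_nonneg_left hω hr0.le)
    rw [Set.mem_ofPred_eq, Real.cosh_eq]
    linarith [Real.exp_pos (-(r * ‖∑ t, Y t ω‖))]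
  have hle := (mul_le_mul_of_nonneg_left (measureReal_mono hsub) (by positivity)).trans
    (hmarkov.trans hm)
  rw [hexpo] at hle
  have hfin : P.real {ω | n * ε ≤ ‖∑ t, Y t ω‖} ≤
      2 * (Real.exp (-(r * (n * ε))) * Real.exp (n * r * ε / 2)) := by
    have hpos := Real.exp_pos (r * (n * ε))
    rw [Real.exp_neg]
    have : 2 * ((Real.exp (r * (n * ε)))⁻¹ * Real.exp (n * r * ε / 2)) =
      Real.exp (n * r * ε / 2) / (Real.exp (r * (n * ε)) / 2) := by field_simp
    rw [this, le_div_iff₀ (by positivity), mul_comm]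
    exact hle
  refine hfin.trans_eq ?_
  rw [← Real.exp_add]
  congr 2
  rw [hr]
  field_simp
  ring

end Bernstein

/-! ### Concentration of random matrices -/

section RandomMatrix

variable {X κ : Type*} [MeasurableSpace X] [Fintype κ] [DecidableEq κ] {P : Measure X}
  {F : X → Matrix κ κ ℂ} {B : ℝ}

theorem isFiniteMeasure_outcomeLaw {ι : Type*} (vol : Measure X) (ψ : ι → X → ℂ)
    (ρ : Matrix ι ι ℂ) : IsFiniteMeasure (outcomeLaw vol ψ ρ) :=
  isFiniteMeasure_withDensity_ofReal integrable_bornDensity.re.hasFiniteIntegral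

theorem integrable_entry [IsFiniteMeasure P] (hF : ∀ a b, Measurable fun μ => F μ a b)
    (hB : ∀ μ, ‖F μ‖ ≤ B) (a b : κ) : Integrable (fun μ => F μ a b) P :=
  Integrable.of_bound (hF a b).aestronglyMeasurable B
    (ae_of_all _ fun μ => (norm_entry_le_l2_opNorm _ a b).trans (hB μ))

theorem integrable_entry_sq [IsFiniteMeasure P] (hF : ∀ a b, Measurable fun μ => F μ a b)
    (hB : ∀ μ, ‖F μ‖ ≤ B) (a b : κ) : Integrable (fun μ => ‖F μ a b‖ ^ 2) P := by
  refine Integrable.of_bound ((hF a b).norm.pow_const 2).aestronglyMeasurable (B ^ 2)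
    (ae_of_all _ fun μ => ?_)
  rw [Real.norm_of_nonneg (by positivity)]
  exact pow_le_pow_left₀ (norm_nonneg _) ((norm_entry_le_l2_opNorm _ a b).trans (hB μ)) 2

/-- The mean square of the Frobenius norm is the trace of the second moment. -/
theorem sum_integral_norm_sq_le [IsFiniteMeasure P] (hF : ∀ a b, Measurable fun μ => F μ a b)
    (hB : ∀ μ, ‖F μ‖ ≤ B) (hH : ∀ μ, (F μ).IsHermitian) :
    ∑ a, ∑ b, ∫ μ, ‖F μ a b‖ ^ 2 ∂P ≤ Fintype.card κ * ‖matrixExp P fun μ => F μ ^ 2‖ := by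
  have h : ∀ a, ∑ b, ∫ μ, ‖F μ a b‖ ^ 2 ∂P ≤ ‖matrixExp P fun μ => F μ ^ 2‖ := by
    intro a
    refine le_trans (le_of_eq ?_)
      ((Complex.re_le_norm _).trans (norm_entry_le_l2_opNorm (matrixExp P fun μ => F μ ^ 2) a a))
    have h1 : ∀ μ, (F μ ^ 2) a a = ((∑ b, ‖F μ a b‖ ^ 2 : ℝ) : ℂ) := by
      intro μ
      rw [sq, Matrix.mul_apply, Complex.ofReal_sum]
      refine Finset.sum_congr rfl fun b _ => ?_
      rw [← (hH μ).apply b a, ← Complex.normSq_eq_norm_sq]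
      exact Complex.mul_conj _
    simp only [matrixExp, Matrix.of_apply, h1]
    rw [integral_complex_ofReal, Complex.ofReal_re,
      integral_finsetSum _ fun b _ => integrable_entry_sq hF hB a b]
  rw [← nsmul_eq_mul]
  exact Finset.sum_le_card_nsmul _ _ _ fun a _ => h a

theorem integral_norm_sub_sq_le [IsProbabilityMeasure P] {f : X → ℂ} (hf : Integrable f P)
    (hf2 : Integrable (fun μ => ‖f μ‖ ^ 2) P) :
    ∫ μ, ‖f μ - ∫ μ, f μ ∂P‖ ^ 2 ∂P ≤ ∫ μ, ‖f μ‖ ^ 2 ∂P := by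
  set m := ∫ μ, f μ ∂P with hm
  have h : ∀ μ, ‖f μ - m‖ ^ 2 = ‖f μ‖ ^ 2 - 2 * inner ℝ m (f μ) + ‖m‖ ^ 2 := fun μ => by
    rw [norm_sub_sq_real, real_inner_comm]
  have hi : Integrable (fun μ => 2 * inner ℝ m (f μ)) P := (hf.const_inner m).const_mul 2
  have hi2 : Integrable (fun μ => ‖f μ‖ ^ 2 - 2 * inner ℝ m (f μ)) P := hf2.sub hi
  simp only [h]
  rw [integral_add hi2 (integrable_const _), integral_sub hf2 hi, integral_const_mul,
    integral_inner hf, ← hm, real_inner_self_eq_norm_sq]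
  simp
  nlinarith [sq_nonneg ‖m‖]

/-- A finite matrix as a vector of the Euclidean space of its entries, that is, with the Frobenius
norm. -/
noncomputable def frobeniusVec (A : Matrix κ κ ℂ) : EuclideanSpace ℂ (κ × κ) :=
  WithLp.toLp 2 fun p => A p.1 p.2

omit [DecidableEq κ] in
theorem norm_frobeniusVec_sq (A : Matrix κ κ ℂ) :
    ‖frobeniusVec A‖ ^ 2 = ∑ a, ∑ b, ‖A a b‖ ^ 2 := by
  rw [EuclideanSpace.norm_sq_eq, Fintype.sum_prod_type]
  rfl

theorem l2_opNorm_le_norm_frobeniusVec (A : Matrix κ κ ℂ) : ‖A‖ ≤ ‖frobeniusVec A‖ := by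
  rw [← sq_le_sq₀ (norm_nonneg _) (norm_nonneg _), norm_frobeniusVec_sq]
  exact l2_opNorm_sq_le_sum A

theorem norm_frobeniusVec_le (A : Matrix κ κ ℂ) : ‖frobeniusVec A‖ ≤ Fintype.card κ * ‖A‖ := by
  rw [← sq_le_sq₀ (norm_nonneg _) (by positivity), norm_frobeniusVec_sq, mul_pow]
  refine (sum_norm_sq_le_card_mul A).trans ?_
  gcongr
  exact_mod_cast Nat.le_self_pow two_ne_zero _

/-- Concentration of the empirical mean of a bounded random Hermitian matrix. The operator norm is
dominated by the Frobenius norm, for which Bernstein's inequality holds without a dimensional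
factor; the variance in the Frobenius norm is at most `card κ` times the norm of the second
moment. -/
theorem measure_norm_mean_sub_le {Ω : Type*} [MeasurableSpace Ω] {Pr : Measure Ω}
    [IsProbabilityMeasure Pr] (hF : ∀ a b, Measurable fun μ => F μ a b)
    (hH : ∀ μ, (F μ).IsHermitian) {R V : ℝ} (hR0 : 0 ≤ R)
    (hR : ∀ μ, ‖F μ - matrixExp P F‖ ≤ R) [Nonempty κ]
    (hV0 : 0 < V) (hV : ‖matrixExp P fun μ => F μ ^ 2‖ ≤ V) {T : ℕ} (hT : 0 < T)
    (S : Fin T → Ω → X) (hS : ∀ t, HasLaw (S t) P Pr) (hind : iIndepFun S Pr)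
    {ε : ℝ} (hε : 0 < ε) :
    1 - 2 * Real.exp (-(T * ε ^ 2 / (2 * (Fintype.card κ * V + Fintype.card κ * R * ε / 2)))) ≤
      Pr.real {ω | ‖(T : ℂ)⁻¹ • ∑ t, F (S t ω) - matrixExp P F‖ ≤ ε} := by
  have hPprob : IsProbabilityMeasure P := by
    rw [← (hS ⟨0, hT⟩).map_eq]
    exact Measure.isProbabilityMeasure_map (hS ⟨0, hT⟩).aemeasurable
  have hB : ∀ μ, ‖F μ‖ ≤ R + ‖matrixExp P F‖ := fun μ => by
    linarith [norm_sub_norm_le (F μ) (matrixExp P F), hR μ]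
  set Y : Fin T → Ω → EuclideanSpace ℂ (κ × κ) :=
    fun t ω => frobeniusVec (F (S t ω) - matrixExp P F) with hYdef
  have hgm : Measurable fun μ => frobeniusVec (F μ - matrixExp P F) := by
    refine (WithLp.measurable_toLp 2 (κ × κ → ℂ)).comp (measurable_pi_lambda _ fun p => ?_)
    exact (hF p.1 p.2).sub_const _
  have hYm : ∀ t, AEMeasurable (Y t) Pr := fun t => hgm.comp_aemeasurable (hS t).aemeasurable
  have hYind : iIndepFun Y Pr := hind.comp (fun _ => fun μ => frobeniusVec (F μ - matrixExp P F))
    fun _ => hgm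
  have hYb : ∀ t ω, ‖Y t ω‖ ≤ Fintype.card κ * R := fun t ω =>
    (norm_frobeniusVec_le _).trans (by gcongr; exact hR _)
  have hgi : Integrable (fun μ => frobeniusVec (F μ - matrixExp P F)) P :=
    Integrable.of_bound hgm.aestronglyMeasurable (Fintype.card κ * R)
      (ae_of_all _ fun μ => (norm_frobeniusVec_le _).trans (by gcongr; exact hR _))
  have hYmean : ∀ t, ∫ ω, Y t ω ∂Pr = 0 := by
    intro t
    have h1 : ∫ ω, Y t ω ∂Pr = ∫ μ, frobeniusVec (F μ - matrixExp P F) ∂P :=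
      (hS t).integral_comp hgm.aestronglyMeasurable
    rw [h1]
    ext p
    have h2 := (EuclideanSpace.proj (𝕜 := ℂ) p).integral_comp_comm hgi
    have h3 : ∫ μ, (F μ p.1 p.2 - matrixExp P F p.1 p.2) ∂P = 0 := by
      rw [integral_sub (integrable_entry hF hB _ _) (integrable_const _)]
      simp [matrixExp]
    exact h2.symm.trans h3
  have hYv : ∀ t, ∫ ω, ‖Y t ω‖ ^ 2 ∂Pr ≤ Fintype.card κ * V := by
    intro t
    have h1 : ∫ ω, ‖Y t ω‖ ^ 2 ∂Pr = ∫ μ, ‖frobeniusVec (F μ - matrixExp P F)‖ ^ 2 ∂P :=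
      (hS t).integral_comp (f := fun μ => ‖frobeniusVec (F μ - matrixExp P F)‖ ^ 2)
        (hgm.norm.pow_const 2).aestronglyMeasurable
    have hi : ∀ a b, Integrable (fun μ => ‖(F μ - matrixExp P F) a b‖ ^ 2) P := fun a b =>
      integrable_entry_sq (F := fun μ => F μ - matrixExp P F)
        (fun a b => (hF a b).sub_const _) hR a b
    rw [h1]
    simp only [norm_frobeniusVec_sq]
    rw [integral_finsetSum _ fun a _ => integrable_finsetSum _ fun b _ => hi a b]
    calc _ = ∑ a, ∑ b, ∫ μ, ‖(F μ - matrixExp P F) a b‖ ^ 2 ∂P :=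
          Finset.sum_congr rfl fun a _ => integral_finsetSum _ fun b _ => hi a b
      _ ≤ ∑ a, ∑ b, ∫ μ, ‖F μ a b‖ ^ 2 ∂P :=
          Finset.sum_le_sum fun a _ => Finset.sum_le_sum fun b _ =>
            integral_norm_sub_sq_le (integrable_entry hF hB a b) (integrable_entry_sq hF hB a b)
      _ ≤ _ := (sum_integral_norm_sq_le hF hB hH).trans (by gcongr)
  have hcard : (0 : ℝ) < Fintype.card κ := by exact_mod_cast Fintype.card_pos
  have hbern := measure_norm_sum_ge_le hYm hYind (by positivity) hYb hYmean (by positivity) hYv hε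
  rw [Fintype.card_fin] at hbern
  set good := {ω | ‖(T : ℂ)⁻¹ • ∑ t, F (S t ω) - matrixExp P F‖ ≤ ε} with hgood
  set bad := {ω | T * ε ≤ ‖∑ t, Y t ω‖} with hbad
  have hT' : (0 : ℝ) < T := by exact_mod_cast hT
  have hcover : Set.univ ⊆ good ∪ bad := by
    intro ω _
    by_cases h : T * ε ≤ ‖∑ t, Y t ω‖
    · exact Or.inr h
    · left
      push Not at h
      have h1 : ∑ t, Y t ω =
          (T : ℂ) • frobeniusVec ((T : ℂ)⁻¹ • ∑ t, F (S t ω) - matrixExp P F) := by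
        have hT0 : (T : ℂ) ≠ 0 := by exact_mod_cast hT.ne'
        ext p
        simp [Y, frobeniusVec, Matrix.sum_apply, Finset.sum_apply, mul_sub,
          mul_inv_cancel_left₀ hT0]
      rw [h1, norm_smul, Complex.norm_natCast] at h
      exact (l2_opNorm_le_norm_frobeniusVec _).trans (lt_of_mul_lt_mul_left h hT'.le).le
  have h1 : (1 : ℝ) ≤ Pr.real good + Pr.real bad := by
    rw [← probReal_univ (μ := Pr)]
    exact (measureReal_mono hcover).trans (measureReal_union_le _ _)
  linarith

end RandomMatrix

/-- The number of samples suffices for a failure probability `δ`: since `M ≥ 1`, the factor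
`N ^ (2 * M)` dominates both `N ^ M` and `N ^ (M + 1)`, and `log 2N ≥ log 2`. -/
theorem two_mul_exp_neg_le {M N T : ℕ} (hM : 0 < M) (hN : 0 < N) {V R ε δ : ℝ} (hV : 0 < V)
    (hR : 0 ≤ R) (hε : 0 < ε) (hδ : 0 < δ) (hδ1 : δ < 1)
    (hT : 2 * (N : ℝ) ^ (2 * M) * (V + R * ε / (2 * N)) / ε ^ 2 *
      (Real.log (2 * N) + Real.log (1 / δ)) ≤ T) :
    2 * Real.exp (-(T * ε ^ 2 / (2 * ((N : ℝ) ^ M * V + (N : ℝ) ^ M * R * ε / 2)))) ≤ δ := by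
  have hN1 : (1 : ℝ) ≤ N := by exact_mod_cast hN
  have hN0 : (0 : ℝ) < N := by linarith
  set D := (N : ℝ) ^ M * V + (N : ℝ) ^ M * R * ε / 2 with hD
  have hD0 : 0 < D := by positivity
  have hDle : D ≤ (N : ℝ) ^ (2 * M) * (V + R * ε / (2 * N)) := by
    have h1 : (N : ℝ) ^ M ≤ (N : ℝ) ^ (2 * M) := pow_le_pow_right₀ hN1 (by omega)
    have h2 : (N : ℝ) ^ (M + 1) ≤ (N : ℝ) ^ (2 * M) := pow_le_pow_right₀ hN1 (by omega)
    have h3 : (N : ℝ) ^ M * R * ε / 2 = (N : ℝ) ^ (M + 1) * (R * ε / (2 * N)) := by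
      rw [pow_succ]; field_simp
    rw [hD, h3, mul_add]
    gcongr
  have hlog : Real.log (2 / δ) ≤ Real.log (2 * N) + Real.log (1 / δ) := by
    rw [← Real.log_mul (by positivity) (by positivity)]
    refine Real.log_le_log (by positivity) ?_
    rw [mul_one_div]
    gcongr
    linarith
  have hlog0 : 0 ≤ Real.log (2 / δ) := Real.log_nonneg (by rw [le_div_iff₀ hδ]; linarith)
  have hmain : Real.log (2 / δ) ≤ T * ε ^ 2 / (2 * D) := by
    rw [le_div_iff₀ (by positivity)]
    have h := mul_le_mul_of_nonneg_right hT (by positivity : 0 ≤ ε ^ 2)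
    refine le_trans ?_ h
    calc Real.log (2 / δ) * (2 * D)
        ≤ (Real.log (2 * N) + Real.log (1 / δ)) *
          (2 * ((N : ℝ) ^ (2 * M) * (V + R * ε / (2 * N)))) := by gcongr; linarith
      _ = _ := by field_simp
  calc _ ≤ 2 * Real.exp (-Real.log (2 / δ)) := by gcongr
    _ = δ := by
      rw [Real.exp_neg, Real.exp_log (by positivity)]
      field_simp

theorem theorem3 {M N : ℕ} (hM : 0 < M) (hN : 0 < N)
    {X : Fin M → Type*} [∀ i, MeasurableSpace (X i)]
    (vol : ∀ i, Measure (X i)) [∀ i, SigmaFinite (vol i)]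
    (ψ : ∀ i, ℕ → X i → ℂ) (σ : ∀ i, X i → Matrix (Fin N) (Fin N) ℂ)
    (hσ : ∀ i, IsShadowProtocol N (vol i) (ψ i) (σ i))
    (ρ : Matrix (Fin M → ℕ) (Fin M → ℕ) ℂ) (hρ : IsDensityOperator ρ)
    {κ : Type*} (c : κ → ℂ) (A : κ → Fin M → Matrix ℕ ℕ ℂ)
    (hc : Summable fun α => ‖c α‖) (hA : ∃ K : ℝ, ∀ α i, TraceNormLE (A α i) K)
    (hexp : ∀ a b, HasSum (fun α => c α * tensorOp (A α) a b) (ρ a b))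
    (ν₁ : ℝ)
    (hν : IsLUB (Set.range fun x : κ × Fin M =>
      ‖secondMoment (vol x.2) (ψ x.2) (σ x.2) (A x.1 x.2)‖) (ν₁ ^ 2))
    (R : ℝ)
    (hR : ∀ μ, ‖localSnapshot σ μ -
      matrixExp (outcomeLaw (Measure.pi vol) (prodAmp ψ) ρ) (localSnapshot σ)‖ ≤ R) :
    ‖matrixExp (outcomeLaw (Measure.pi vol) (prodAmp ψ) ρ) (fun μ => localSnapshot σ μ ^ 2)‖
        ≤ ν₁ ^ (2 * M) * ∑' α, ‖c α‖ ∧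
      ∀ ε δ : ℝ, 0 < ε → ε < 1 → 0 < δ → δ < 1 → ∀ T : ℕ,
        2 * (N : ℝ) ^ (2 * M) * (ν₁ ^ (2 * M) * (∑' α, ‖c α‖) + R * ε / (2 * N)) / ε ^ 2 *
            (Real.log (2 * N) + Real.log (1 / δ)) ≤ T →
        ∀ {Ω : Type*} [MeasurableSpace Ω] (Pr : Measure Ω) [IsProbabilityMeasure Pr]
          (S : Fin T → Ω → ∀ i, X i),
          (∀ t, HasLaw (S t) (outcomeLaw (Measure.pi vol) (prodAmp ψ) ρ) Pr) →
          iIndepFun S Pr →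
          1 - δ ≤ Pr.real {ω | ‖localShadow σ (fun t => S t ω) - regularize N ρ‖ ≤ ε} := by

  obtain ⟨K, hK⟩ := hA
  set P := outcomeLaw (Measure.pi vol) (prodAmp ψ) ρ with hP
  have hB : ∀ μ, ‖localSnapshot σ μ‖ ≤ R + ‖matrixExp P (localSnapshot σ)‖ := fun μ => by
    linarith [norm_sub_norm_le (localSnapshot σ μ) (matrixExp P (localSnapshot σ)), hR μ]
  obtain ⟨C, hC0, hC⟩ := exists_snapshot_bound hN hσ hB
  have hvar : ‖matrixExp P fun μ => localSnapshot σ μ ^ 2‖ ≤ ν₁ ^ (2 * M) * ∑' α, ‖c α‖ :=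
    norm_matrixExp_sq_le hσ hρ hc hK hexp hC0 hC fun α i => hν.1 ⟨(α, i), rfl⟩
  refine ⟨hvar, fun ε δ hε _ hδ hδ1 T hT Ω _ Pr _ S hS hind => ?_⟩
  set V := ν₁ ^ (2 * M) * ∑' α, ‖c α‖ with hV
  have hmean : matrixExp P (localSnapshot σ) = regularize N ρ := matrixExp_localSnapshot hσ hρ hC
  have hmeas : ∀ a b, Measurable fun μ => localSnapshot σ μ a b := fun a b =>
    measurable_prod_comp fun i => (hσ i).snapshot_measurable (a i) (b i)
  have hherm : ∀ μ, (localSnapshot σ μ).IsHermitian := fun μ =>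
    isHermitian_tensorOp fun i => (hσ i).snapshot_hermitian (μ i)
  have hfin : IsFiniteMeasure P := isFiniteMeasure_outcomeLaw _ _ _
  have hR0 : 0 ≤ R := by
    choose μ₀ _ using fun i => (hσ i).exists_entry_ne_zero hN
    exact (norm_nonneg _).trans (hR μ₀)
  have hV0 : 0 ≤ V := (norm_nonneg _).trans hvar
  rcases hV0.eq_or_lt with hV0 | hV0
  · -- zero variance: the snapshot vanishes almost surely, and so does its expectation
    rw [← hV0] at hvar
    have hsq := sum_integral_norm_sq_le (P := P) hmeas hB hherm
    have hzero : ∀ᵐ μ ∂P, localSnapshot σ μ = 0 := by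
      have h0 : ∀ a b, ∫ μ, ‖localSnapshot σ μ a b‖ ^ 2 ∂P = 0 := by
        have h1 : ∀ a b, 0 ≤ ∫ μ, ‖localSnapshot σ μ a b‖ ^ 2 ∂P := fun a b =>
          integral_nonneg fun μ => by positivity
        have h2 : ∑ a, ∑ b, ∫ μ, ‖localSnapshot σ μ a b‖ ^ 2 ∂P ≤ 0 := by
          refine hsq.trans ?_
          rw [le_antisymm hvar (norm_nonneg _), mul_zero]
        have h3 := (Finset.sum_eq_zero_iff_of_nonneg fun a _ =>
          Finset.sum_nonneg fun b _ => h1 a b).mp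
            (le_antisymm h2 (Finset.sum_nonneg fun a _ => Finset.sum_nonneg fun b _ => h1 a b))
        intro a b
        exact (Finset.sum_eq_zero_iff_of_nonneg fun b _ => h1 a b).mp (h3 a (Finset.mem_univ a)) b
          (Finset.mem_univ b)
      have h4 : ∀ᵐ μ ∂P, ∀ a b, localSnapshot σ μ a b = 0 := by
        simp only [ae_all_iff]
        intro a b
        filter_upwards [(integral_eq_zero_iff_of_nonneg (fun μ => by positivity)
          (integrable_entry_sq hmeas hB a b)).mp (h0 a b)] with μ hμ
        simpa using hμ
      filter_upwards [h4] with μ hμ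
      ext a b
      exact hμ a b
    have hreg : regularize N ρ = 0 := by
      rw [← hmean]
      ext a b
      refine integral_eq_zero_of_ae ?_
      filter_upwards [hzero] with μ hμ
      rw [hμ]
      rfl
    have hall : ∀ᵐ ω ∂Pr, ∀ t, localSnapshot σ (S t ω) = 0 := by
      rw [ae_all_iff]
      intro t
      refine ae_of_ae_map (hS t).aemeasurable (p := fun μ => localSnapshot σ μ = 0) ?_
      rw [(hS t).map_eq]
      exact hzero
    have hone : Pr {ω | ‖localShadow σ (fun t => S t ω) - regularize N ρ‖ ≤ ε} = 1 := by
      rw [← measure_univ (μ := Pr)]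
      refine measure_congr (eventuallyEq_univ.mpr ?_)
      filter_upwards [hall] with ω hω
      simp [localShadow, hω, hreg, hε.le]
    rw [Measure.real, hone]
    simp [hδ.le]
  · have hN0 : (0 : ℝ) < N := by exact_mod_cast hN
    have hTpos : 0 < T := by
      have hlog : 0 < Real.log (2 * N) + Real.log (1 / δ) := by
        have h1 : (1 : ℝ) ≤ N := by exact_mod_cast hN
        have h2 : 0 < Real.log (2 * N) := Real.log_pos (by linarith)
        have h3 : 0 < Real.log (1 / δ) := Real.log_pos (by rw [lt_div_iff₀ hδ]; linarith)
        linarith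
      have hT' : (0 : ℝ) < T := lt_of_lt_of_le (by positivity) hT
      exact_mod_cast hT'
    have : Nonempty (Fin M → Fin N) := ⟨fun _ => ⟨0, hN⟩⟩
    have h := measure_norm_mean_sub_le hmeas hherm hR0 hR hV0 hvar hTpos S hS hind hε
    have hcard : (Fintype.card (Fin M → Fin N) : ℝ) = (N : ℝ) ^ M := by simp
    rw [hcard, hmean] at h
    have hexp := two_mul_exp_neg_le hM hN hV0 hR0 hε hδ hδ1 hT
    exact le_trans (by linarith) h
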